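/- Let $0\le c<g$ be integers. Let $A_g=\mathrm{Sp}_{2g}(\mathbb Z)\backslash\mathfrak H_g$ be the moduli space of $g$-dimensional principally polarized complex abelian varieties, and let $\overline{A_g}=A_g\sqcup A_{g-1}\sqcup\cdots\sqcup A_0$ be its Satake–Baily–Borel compactification, with the Satake topology. For a principally polarized abelian variety $V$, let $d(V)$ be the distance of the flat Kähler metric given by the polarization. Let $p$ be a point of the stratum $A_c\subset\overline{A_g}$. (1) Let $(V_i)_{i\ge 1}$ be a sequence of $g$-dimensional principally polarized complex abelian varieties whose classes in $A_g$ converge to $p$ in $\overline{A_g}$. Then there are an integer $r$ with $c\le r<g$, a flat torus $T=\mathbb R^{g-r}/\Lambda$ ($\Lambda$ a lattice in Euclidean space $\mathbb R^{g-r}$) of diameter $1$, and a subsequence of $\bigl(V_i,\ d(V_i)/\operatorname{diam}(d(V_i))\bigr)$ that converges to $T$ in the Gromov–Hausdorff sense. (2) Conversely, for every integer $r$ with $c\le r<g$ and every flat torus $T=\mathbb R^{g-r}/\Lambda$ of diameter $1$, there is a sequence $(V_i)_{i\ge 1}$ of $g$-dimensional principally polarized complex abelian varieties whose classes in $A_g$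 converge to $p$ in $\overline{A_g}$ and such that $\bigl(V_i,\ d(V_i)/\operatorname{diam}(d(V_i))\bigr)$ converges to $T$ in the Gromov–Hausdorff sense. -/

import Mathlib

open Topology Filter

/-! ### Flat tori and normalization of the diameter -/

/-- The flat torus `E / Λ`, where `Λ` is a lattice in a finite-dimensional real vector space `E`
(with a Euclidean norm in all uses below). Its metric is the quotient metric
`d([x], [y]) = inf_{l ∈ Λ} ‖x - y + l‖`, that is, the geodesic distance of the flat Riemannian
metric induced by the norm. -/
abbrev FlatTorus {E : Type*} [NormedAddCommGroup E] (Λ : Submodule ℤ E) : Type _ :=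
  E ⧸ Λ.toAddSubgroup

instance FlatTorus.isClosed {E : Type*} [NormedAddCommGroup E]
    (Λ : Submodule ℤ E) [hΛ : DiscreteTopology Λ] :
    IsClosed (Λ.toAddSubgroup : Set E) :=
  @AddSubgroup.isClosed_of_discrete E _ _ _ _ Λ.toAddSubgroup hΛ

instance FlatTorus.compactSpace {E : Type*} [NormedAddCommGroup E] [NormedSpace ℝ E]
    [FiniteDimensional ℝ E] (Λ : Submodule ℤ E) [DiscreteTopology Λ] [IsZLattice ℝ Λ] :
    CompactSpace (FlatTorus Λ) := by
  classical
  have : ProperSpace E := FiniteDimensional.proper ℝ E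
  have : Module.Free ℤ Λ := ZLattice.module_free ℝ Λ
  have : Module.Finite ℤ Λ := ZLattice.module_finite ℝ Λ
  let b := (Module.Free.chooseBasis ℤ Λ).ofZLatticeBasis ℝ Λ
  obtain ⟨R, hR⟩ := (ZSpan.fundamentalDomain_isBounded b).subset_closedBall (0 : E)
  have hcont : Continuous (fun x : E => (x : E ⧸ Λ.toAddSubgroup)) :=
    QuotientAddGroup.continuous_mk
  refine ⟨?_⟩
  have : (Set.univ : Set (FlatTorus Λ)) =
      (fun x : E => (x : E ⧸ Λ.toAddSubgroup)) '' Metric.closedBall (0 : E) R := by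
    refine (Set.eq_univ_of_forall fun y => ?_).symm
    obtain ⟨x, rfl⟩ := QuotientAddGroup.mk_surjective y
    refine ⟨ZSpan.fract b x, hR (ZSpan.fract_mem_fundamentalDomain b x), ?_⟩
    refine QuotientAddGroup.eq.2 ?_
    have h : (ZSpan.floor b x : E) ∈ Λ :=
      (Module.Basis.ofZLatticeBasis_span ℝ Λ (Module.Free.chooseBasis ℤ Λ)).le
        (ZSpan.floor b x).2
    have h2 : -ZSpan.fract b x + x = ZSpan.floor b x := by
      rw [ZSpan.fract_apply]; abel
    rw [h2]
    exact h
  rw [this]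
  exact (isCompact_closedBall (0 : E) R).image hcont

/-- A copy of `X`, carrying the metric `d / diam d` (see the instance below). -/
def DiamNormalized (X : Type*) : Type _ := X

instance DiamNormalized.nonempty (X : Type*) [h : Nonempty X] : Nonempty (DiamNormalized X) := h

/-- The metric `d / diam d` on a compact metric space `X`. (If `X` has at most one point, this is
the zero metric.) -/
noncomputable instance DiamNormalized.metricSpace (X : Type*) [MetricSpace X] [CompactSpace X] :
    MetricSpace (DiamNormalized X) where
  dist x y := @dist X _ x y / Metric.diam (Set.univ : Set X)
  dist_self x := by
    have h : @dist X _ x x = 0 := @dist_self X _ x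
    exact div_eq_zero_iff.2 (Or.inl h)
  dist_comm x y :=
    congrArg (fun t : ℝ => t / Metric.diam (Set.univ : Set X)) (@dist_comm X _ x y)
  dist_triangle x y z := by
    rw [← add_div]
    exact div_le_div_of_nonneg_right (@dist_triangle X _ x y z) Metric.diam_nonneg
  eq_of_dist_eq_zero {x y} h := by
    have hb : @dist X _ x y ≤ Metric.diam (Set.univ : Set X) :=
      Metric.dist_le_diam_of_mem isCompact_univ.isBounded (Set.mem_univ _) (Set.mem_univ _)
    refine (@dist_le_zero X _ x y).1 ?_
    rcases div_eq_zero_iff.1 h with h | h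
    · exact h.le
    · exact hb.trans h.le

theorem DiamNormalized.dist_eq (X : Type*) [MetricSpace X] [CompactSpace X] (x y : X) :
    @dist (DiamNormalized X) _ x y = @dist X _ x y / Metric.diam (Set.univ : Set X) := rfl

instance DiamNormalized.compactSpace (X : Type*) [MetricSpace X] [CompactSpace X] :
    CompactSpace (DiamNormalized X) := by
  let f : X → DiamNormalized X := fun x => x
  have hf : Continuous f := by
    refine LipschitzWith.continuous
      (K := ⟨(Metric.diam (Set.univ : Set X))⁻¹, inv_nonneg.2 Metric.diam_nonneg⟩)
      (LipschitzWith.of_dist_le_mul fun x y => ?_)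
    change @dist X _ x y / Metric.diam (Set.univ : Set X) ≤
      (Metric.diam (Set.univ : Set X))⁻¹ * @dist X _ x y
    rw [div_eq_inv_mul]
  refine ⟨?_⟩
  have : (Set.univ : Set (DiamNormalized X)) = f '' (Set.univ : Set X) :=
    (Set.eq_univ_of_forall fun y => Set.mem_image_of_mem f (Set.mem_univ (α := X) y)).symm
  rw [this]
  exact isCompact_univ.image hf

/-! ### The Siegel upper half space and the moduli space `A_g` -/

/-- The Siegel upper half space `ℌ_g` of symmetric complex `g × g` matrices with positive definite
imaginary part (one point for `g = 0`), with the topology of the space of matrices. -/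
def SiegelUpperHalfSpace (g : ℕ) : Type :=
  {Z : Matrix (Fin g) (Fin g) ℂ // Z.IsSymm ∧ (Z.map Complex.im).PosDef}

instance (g : ℕ) : TopologicalSpace (SiegelUpperHalfSpace g) :=
  inferInstanceAs (TopologicalSpace {Z : Matrix (Fin g) (Fin g) ℂ //
    Z.IsSymm ∧ (Z.map Complex.im).PosDef})

/-- `W = (A Z + B) (C Z + D)⁻¹` for some integral symplectic matrix `(A B; C D)`. The equation is
written without the inverse; `C Z + D` is always invertible. -/
def SiegelRel {g : ℕ} (Z W : SiegelUpperHalfSpace g) : Prop :=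
  ∃ M ∈ Matrix.symplecticGroup (Fin g) ℤ,
    W.1 * (M.toBlocks₂₁.map (Int.cast : ℤ → ℂ) * Z.1 + M.toBlocks₂₂.map (Int.cast : ℤ → ℂ)) =
      M.toBlocks₁₁.map (Int.cast : ℤ → ℂ) * Z.1 + M.toBlocks₁₂.map (Int.cast : ℤ → ℂ)

/-- The moduli space `A_g = Sp_{2g}(ℤ) \ ℌ_g` of principally polarized abelian varieties, with the
quotient topology. -/
def SiegelModuli (g : ℕ) : Type := Quot (SiegelRel (g := g))

/-- The class in `A_g` of a point of the Siegel upper half space. -/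
def SiegelModuli.mk {g : ℕ} (Z : SiegelUpperHalfSpace g) : SiegelModuli g := Quot.mk _ Z

/-! ### The Satake–Baily–Borel compactification -/

/-- The upper left `c × c` block of a point of `ℌ_m`, a point of `ℌ_c`. -/
def SiegelUpperHalfSpace.upperLeft {c m : ℕ} (h : c ≤ m) (Z : SiegelUpperHalfSpace m) :
    SiegelUpperHalfSpace c :=
  ⟨Z.1.submatrix (Fin.castLE h) (Fin.castLE h), Z.2.1.submatrix _,
    Z.2.2.submatrix (Fin.castLE_injective h)⟩

/-- Write `Im Z = (Y₁ Y₃; ᵗY₃ Y₂)` with `Y₁` of size `c × c`. The condition is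
`Y₂ - ᵗY₃ Y₁⁻¹ Y₃ > T · 1` (in the sense of positive definite matrices); since `Y₁ > 0`, this
says that `Im Z - diag(0, …, 0, T, …, T)` (with `c` zeros) is positive definite. -/
def SiegelUpperHalfSpace.IsDeep {m : ℕ} (c : ℕ) (T : ℝ) (Z : SiegelUpperHalfSpace m) : Prop :=
  (Z.1.map Complex.im -
    Matrix.diagonal (fun i : Fin m => if (i : ℕ) < c then (0 : ℝ) else T)).PosDef

/-- The underlying set `A_g ⊔ A_{g-1} ⊔ ⋯ ⊔ A_0` of the Satake–Baily–Borel compactification. -/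
def SatakeBB (g : ℕ) : Type := Σ c : Fin (g + 1), SiegelModuli c

/-- The point of the stratum `A_c` of the Satake–Baily–Borel compactification of `A_g` that is
given by a point of `ℌ_c`. -/
def SatakeBB.mk {g : ℕ} (c : ℕ) (hc : c ≤ g) (Z : SiegelUpperHalfSpace c) : SatakeBB g :=
  ⟨⟨c, Nat.lt_succ_of_le hc⟩, SiegelModuli.mk Z⟩

/-- The topology of the Satake–Baily–Borel compactification, as the quotient of the cylindrical
(Piatetski-Shapiro) topology: a set is open if, together with the class of a point `Z₀ ∈ ℌ_c`, it
contains, for some neighbourhood `W` of `Z₀` and some `T > 0`, the classes of all `Z ∈ ℌ_m`,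
`c ≤ m ≤ g`, whose upper left `c × c` block lies in `W` and which satisfy
`Y₂ - ᵗY₃ Y₁⁻¹ Y₃ > T · 1`. (For `m = c` the last condition is empty.) -/
instance SatakeBB.topologicalSpace (g : ℕ) : TopologicalSpace (SatakeBB g) where
  IsOpen O := ∀ (c : ℕ) (hc : c ≤ g) (Z₀ : SiegelUpperHalfSpace c), SatakeBB.mk c hc Z₀ ∈ O →
    ∃ W ∈ 𝓝 Z₀, ∃ T > (0 : ℝ), ∀ (m : ℕ) (hcm : c ≤ m) (hm : m ≤ g) (Z : SiegelUpperHalfSpace m),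
      Z.upperLeft hcm ∈ W → Z.IsDeep c T → SatakeBB.mk m hm Z ∈ O
  isOpen_univ _ _ _ _ := ⟨Set.univ, univ_mem, 1, one_pos, fun _ _ _ _ _ _ => Set.mem_univ _⟩
  isOpen_inter s t hs ht c hc Z₀ h := by
    obtain ⟨W, hW, T, hT, H⟩ := hs c hc Z₀ h.1
    obtain ⟨W', hW', T', hT', H'⟩ := ht c hc Z₀ h.2
    have mono : ∀ {S S' : ℝ}, S ≤ S' → ∀ {m : ℕ} (Z : SiegelUpperHalfSpace m),
        Z.IsDeep c S' → Z.IsDeep c S := by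
      intro S S' hS m Z hZ
      have h2 : (Matrix.diagonal (fun i : Fin m => if (i : ℕ) < c then (0 : ℝ) else S') -
          Matrix.diagonal (fun i : Fin m => if (i : ℕ) < c then (0 : ℝ) else S)).PosSemidef := by
        rw [Matrix.diagonal_sub]
        refine Matrix.PosSemidef.diagonal fun i => ?_
        by_cases hi : (i : ℕ) < c <;> simp [hi, hS]
      have h3 := Matrix.PosDef.add_posSemidef hZ h2
      rwa [sub_add_sub_cancel] at h3
    exact ⟨W ∩ W', inter_mem hW hW', max T T', lt_max_of_lt_left hT,
      fun m hcm hm Z hZ hZT => ⟨H m hcm hm Z hZ.1 (mono (le_max_left _ _) Z hZT),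
        H' m hcm hm Z hZ.2 (mono (le_max_right _ _) Z hZT)⟩⟩
  isOpen_sUnion S hS c hc Z₀ := by
    rintro ⟨s, hs, h⟩
    obtain ⟨W, hW, T, hT, H⟩ := hS s hs c hc Z₀ h
    exact ⟨W, hW, T, hT, fun m hcm hm Z hZ hZT => ⟨s, hs, H m hcm hm Z hZ hZT⟩⟩

/-! ### Principally polarized abelian varieties -/

/-- A `g`-dimensional principally polarized complex abelian variety `V / Λ`: a complex vector
space `V` of dimension `g`, a lattice `Λ` in `V`, and a principal polarization, i.e. a positive
definite Hermitian form `H` on `V` (here the inner product of `V`) whose imaginary part is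
integral and unimodular on `Λ`. -/
structure PPAV (g : ℕ) where
  /-- the tangent space at the origin -/
  V : Type
  [normedAddCommGroup : NormedAddCommGroup V]
  [innerProductSpace : InnerProductSpace ℂ V]
  [finiteDimensional : FiniteDimensional ℂ V]
  finrank_eq : Module.finrank ℂ V = g
  /-- the period lattice -/
  Λ : Submodule ℤ V
  [discreteTopology : DiscreteTopology Λ]
  [isZLattice : IsZLattice ℝ Λ]
  integral : ∀ x ∈ Λ, ∀ y ∈ Λ, ∃ n : ℤ, (inner ℂ x y : ℂ).im = n
  /-- every integral linear form on `Λ` is `Im H(x, ·)` for some `x ∈ Λ` (automatically unique) -/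
  unimodular : ∀ f : Λ →ₗ[ℤ] ℤ, ∃ x ∈ Λ, ∀ y : Λ, (inner ℂ x (y : V) : ℂ).im = f y

attribute [instance] PPAV.normedAddCommGroup PPAV.innerProductSpace PPAV.finiteDimensional
  PPAV.discreteTopology PPAV.isZLattice

instance PPAV.finiteDimensionalReal {g : ℕ} (A : PPAV g) : FiniteDimensional ℝ A.V :=
  FiniteDimensional.complexToReal A.V

/-- The metric space underlying a principally polarized abelian variety: `V / Λ` with the flat
Kähler metric `Re H` of the polarization. -/
abbrev PPAV.torus {g : ℕ} (A : PPAV g) : Type := FlatTorus A.Λ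

/-- `Z` is a period matrix of `A`: there is a symplectic basis `a₁, …, a_g, b₁, …, b_g` of the
period lattice with `b_j = ∑ i, Z i j • a_i`. -/
def PPAV.HasPeriodMatrix {g : ℕ} (A : PPAV g) (Z : SiegelUpperHalfSpace g) : Prop :=
  ∃ e : Module.Basis (Fin g ⊕ Fin g) ℤ A.Λ,
    (∀ i j, (inner ℂ (e (.inl i) : A.V) (e (.inl j) : A.V) : ℂ).im = 0) ∧
    (∀ i j, (inner ℂ (e (.inr i) : A.V) (e (.inr j) : A.V) : ℂ).im = 0) ∧
    (∀ i j, (inner ℂ (e (.inl i) : A.V) (e (.inr j) : A.V) : ℂ).im = if i = j then 1 else 0) ∧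
    ∀ j, (e (.inr j) : A.V) = ∑ i, Z.1 i j • (e (.inl i) : A.V)

/-- The sequence `A` of principally polarized abelian varieties, regarded as a sequence of points
of `A_g` by means of period matrices, converges to the point `p` of the Satake–Baily–Borel
compactification. -/
def PPAV.ConvergesTo {g : ℕ} (A : ℕ → PPAV g) (p : SatakeBB g) : Prop :=
  ∃ Z : ℕ → SiegelUpperHalfSpace g, (∀ n, (A n).HasPeriodMatrix (Z n)) ∧
    Tendsto (fun n => SatakeBB.mk g le_rfl (Z n)) atTop (𝓝 p)

/-- `A n`, with its flat metric rescaled to diameter one, Gromov–Hausdorff converges to the compact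
metric space `X` as `n → ∞`. -/
def PPAV.GHTendsto {g : ℕ} (A : ℕ → PPAV g) (X : Type) [MetricSpace X] [CompactSpace X]
    [Nonempty X] : Prop :=
  Tendsto (fun n => GromovHausdorff.toGHSpace (DiamNormalized (A n).torus)) atTop
    (𝓝 (GromovHausdorff.toGHSpace X))

/-! The lattice of a period matrix `Z = X + iY` carries the quadratic form `z* Y⁻¹ z`, where `z = x
+ Z y` with integral `x`, `y`. Its short vectors govern the limit of the normalized torus.

Limits are tori. If `Z` is deep over a point of `ℌ_m`, with `k` extra dimensions, then the lattice
vectors of that point lift with a small increase of the norm, and `k` further independent vectors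
are nearly zero (`HasShort.of_upperLeft`). Counting independent vectors below a given length is
invariant under the symplectic group, so such counts cut out open sets of the Satake
compactification (`SatakeBB.isOpen_shortSet`). Near a point of `A_c` this gives `g + c` independent
lattice vectors of bounded length, and also a nonzero lattice vector `v` that is arbitrarily short.
Since `Im H(v, ·)` is integral on the lattice, the diameter is at least `1 / (2‖v‖)`
(`PPAV.one_div_le_diam`). Hence the diameter tends to infinity, and normalization collapses the span
of the bounded vectors. The distances to the rescaled lattices are 1-Lipschitz functions on `ℝ^(2g)`
bounded by one, so a subsequence converges to a function of the same kind
(`IsTorusNorm.exists_subseq_tendsto`). The zero set of the limit is a closed subgroup containing a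
subspace of dimension at least `g + c`, and the quotient by it is a flat torus of dimension at most
`g - c` (`IsTorusNorm.exists_flatTorus`). Its dimension is positive because the diameter one
survives in the limit.

Every torus occurs. Take the block diagonal point with blocks `p`, `i · 1` and `i` times the Gram
matrix of a basis of the given lattice, and scale the coordinates by `1, N, N²`. The vectors `b_j`
of the last block grow like `N²`, all other basis vectors are `O(N)`, and division by `N²` leaves
exactly the given torus (`tendsto_toGHSpace_of_collapse`). -/

open Matrix in
/-- For a real matrix, positive definiteness in terms of the dot product. -/
theorem Matrix.PosDef.dotProduct_pos {n : Type*} [Fintype n] {Y : Matrix n n ℝ} (hY : Y.PosDef)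
    {x : n → ℝ} (hx : x ≠ 0) : 0 < x ⬝ᵥ Y *ᵥ x := by
  simpa using hY.dotProduct_mulVec_pos hx

open Matrix in
theorem Matrix.PosDef.dotProduct_nonneg {n : Type*} [Fintype n] {Y : Matrix n n ℝ} (hY : Y.PosDef)
    (x : n → ℝ) : 0 ≤ x ⬝ᵥ Y *ᵥ x := by
  simpa using hY.posSemidef.dotProduct_mulVec_nonneg x

open Matrix in
theorem Matrix.IsSymm.dotProduct_mulVec_comm {n R : Type*} [Fintype n] [CommSemiring R]
    {Y : Matrix n n R} (hY : Y.IsSymm) (x y : n → R) : x ⬝ᵥ Y *ᵥ y = y ⬝ᵥ Y *ᵥ x := by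
  rw [dotProduct_mulVec, ← mulVec_transpose, hY.eq, dotProduct_comm]

/-! ### The quadratic form of a period matrix and its symplectic invariance -/

namespace SiegelUpperHalfSpace

open Matrix

variable {m : ℕ}

/-- The real part of a point of the Siegel upper half space. -/
def re (Z : SiegelUpperHalfSpace m) : Matrix (Fin m) (Fin m) ℝ := Z.1.map Complex.re

/-- The imaginary part of a point of the Siegel upper half space. -/
def im (Z : SiegelUpperHalfSpace m) : Matrix (Fin m) (Fin m) ℝ := Z.1.map Complex.im

theorem re_isSymm (Z : SiegelUpperHalfSpace m) : Z.re.IsSymm := Z.2.1.map _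

theorem im_isSymm (Z : SiegelUpperHalfSpace m) : Z.im.IsSymm := Z.2.1.map _

theorem im_posDef (Z : SiegelUpperHalfSpace m) : Z.im.PosDef := Z.2.2

theorem isUnit_det_im (Z : SiegelUpperHalfSpace m) : IsUnit Z.im.det :=
  (Matrix.isUnit_iff_isUnit_det _).1 Z.im_posDef.isUnit

theorem im_inv_isSymm (Z : SiegelUpperHalfSpace m) : Z.im⁻¹.IsSymm := by
  have := Z.im_isSymm
  unfold Matrix.IsSymm at *
  rw [transpose_nonsing_inv, this]

theorem im_mulVec_inv_mulVec (Z : SiegelUpperHalfSpace m) (w : Fin m → ℝ) :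
    Z.im *ᵥ (Z.im⁻¹ *ᵥ w) = w := by
  rw [mulVec_mulVec, mul_nonsing_inv _ Z.isUnit_det_im, one_mulVec]

theorem inv_mulVec_im_mulVec (Z : SiegelUpperHalfSpace m) (w : Fin m → ℝ) :
    Z.im⁻¹ *ᵥ (Z.im *ᵥ w) = w := by
  rw [mulVec_mulVec, nonsing_inv_mul _ Z.isUnit_det_im, one_mulVec]

/-- The real part of the point `x + Z y` of `ℂ ^ m`, where `u = (y, x)`. -/
def rePoint (Z : SiegelUpperHalfSpace m) (u : Fin m ⊕ Fin m → ℝ) : Fin m → ℝ :=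
  u ∘ Sum.inr + Z.re *ᵥ (u ∘ Sum.inl)

/-- The point `x + Z y` of `ℂ ^ m`, where `u = (y, x)`. -/
def point (Z : SiegelUpperHalfSpace m) (u : Fin m ⊕ Fin m → ℝ) : Fin m → ℂ :=
  (fun i => ((u (Sum.inr i) : ℝ) : ℂ)) + Z.1 *ᵥ (fun i => ((u (Sum.inl i) : ℝ) : ℂ))

/-- The positive definite quadratic form `z ↦ z* Y⁻¹ z` in the real coordinates `u = (y, x)`,
`z = x + Z y`. -/
noncomputable def form (Z : SiegelUpperHalfSpace m) (u : Fin m ⊕ Fin m → ℝ) : ℝ :=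
  Z.rePoint u ⬝ᵥ Z.im⁻¹ *ᵥ Z.rePoint u + (u ∘ Sum.inl) ⬝ᵥ Z.im *ᵥ (u ∘ Sum.inl)

theorem point_re (Z : SiegelUpperHalfSpace m) (u : Fin m ⊕ Fin m → ℝ) (i : Fin m) :
    (Z.point u i).re = Z.rePoint u i := by
  simp [point, rePoint, re, mulVec, dotProduct]

theorem point_im (Z : SiegelUpperHalfSpace m) (u : Fin m ⊕ Fin m → ℝ) (i : Fin m) :
    (Z.point u i).im = (Z.im *ᵥ (u ∘ Sum.inl)) i := by
  simp [point, im, mulVec, dotProduct]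

/-- The form is the symplectic pairing of a vector with its multiple by `i`. Its invariance thus
reduces to that of `J` and of the complex structure. -/
theorem form_eq_of_point_eq (Z : SiegelUpperHalfSpace m) {u v : Fin m ⊕ Fin m → ℝ}
    (h : Z.point v = Complex.I • Z.point u) :
    Z.form u = u ⬝ᵥ Matrix.J (Fin m) ℝ *ᵥ v := by
  have h1 : Z.rePoint v = - (Z.im *ᵥ (u ∘ Sum.inl)) := by
    ext i
    rw [← point_re, h, Pi.neg_apply, ← point_im]; simp
  have h2 : Z.im *ᵥ (v ∘ Sum.inl) = Z.rePoint u := by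
    ext i
    rw [← point_im, h, ← point_re]; simp
  have h3 : v ∘ Sum.inr = - (Z.im *ᵥ (u ∘ Sum.inl)) - Z.re *ᵥ (v ∘ Sum.inl) := by
    rw [← h1, rePoint]; abel
  have h4 : u ⬝ᵥ Matrix.J (Fin m) ℝ *ᵥ v =
      (u ∘ Sum.inr) ⬝ᵥ (v ∘ Sum.inl) - (u ∘ Sum.inl) ⬝ᵥ (v ∘ Sum.inr) := by
    simp [J, fromBlocks_mulVec, dotProduct, Fintype.sum_sum_type, neg_mulVec]; ring
  rw [h4, h3, form, ← h2, inv_mulVec_im_mulVec, h2, rePoint, add_dotProduct, dotProduct_sub,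
    dotProduct_neg, Z.re_isSymm.dotProduct_mulVec_comm (u ∘ Sum.inl), dotProduct_comm (Z.re *ᵥ _)]
  ring

theorem exists_point_eq (Z : SiegelUpperHalfSpace m) (u : Fin m ⊕ Fin m → ℝ) :
    ∃ v, Z.point v = Complex.I • Z.point u := by
  refine ⟨Sum.elim (Z.im⁻¹ *ᵥ Z.rePoint u)
    (- (Z.im *ᵥ (u ∘ Sum.inl)) - Z.re *ᵥ (Z.im⁻¹ *ᵥ Z.rePoint u)), ?_⟩
  ext i
  apply Complex.ext
  · rw [point_re, rePoint]
    simp [point_im]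
  · rw [point_im]
    simp [point_re, mul_nonsing_inv _ Z.isUnit_det_im]

/-- `HasShort Z k C`: the lattice given by `Z` contains `k` linearly independent vectors of norm
square less than `C`. -/
def HasShort (Z : SiegelUpperHalfSpace m) (k : ℕ) (C : ℝ) : Prop :=
  ∃ v : Fin k → (Fin m ⊕ Fin m → ℤ), LinearIndependent ℤ v ∧
    ∀ i, Z.form (fun j => (v i j : ℝ)) < C

/-- The integral change of coordinates `Mᵀ` is induced by the complex linear map `(C Z + D)ᵀ`, so it
commutes with multiplication by `i`. -/
theorem point_mulVec_of_siegelRel {Z W : SiegelUpperHalfSpace m}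
    {M : Matrix (Fin m ⊕ Fin m) (Fin m ⊕ Fin m) ℤ}
    (h : W.1 * (M.toBlocks₂₁.map (Int.cast : ℤ → ℂ) * Z.1 + M.toBlocks₂₂.map (Int.cast : ℤ → ℂ)) =
      M.toBlocks₁₁.map (Int.cast : ℤ → ℂ) * Z.1 + M.toBlocks₁₂.map (Int.cast : ℤ → ℂ))
    (u : Fin m ⊕ Fin m → ℝ) :
    Z.point ((M.map (Int.cast : ℤ → ℝ))ᵀ *ᵥ u) =
      (M.toBlocks₂₁.map (Int.cast : ℤ → ℂ) * Z.1 + M.toBlocks₂₂.map (Int.cast : ℤ → ℂ))ᵀ *ᵥ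
        W.point u := by
  have hT := congrArg Matrix.transpose h
  rw [transpose_mul, transpose_add, transpose_add, transpose_mul, transpose_mul, Z.2.1.eq,
    W.2.1.eq] at hT
  rw [point, point, mulVec_add, transpose_add, transpose_mul, Z.2.1.eq, mulVec_mulVec, hT]
  have e1 : (fun i => ((((M.map (Int.cast : ℤ → ℝ))ᵀ *ᵥ u) (Sum.inr i) : ℝ) : ℂ)) =
      (M.toBlocks₁₂.map (Int.cast : ℤ → ℂ))ᵀ *ᵥ (fun i => ((u (Sum.inl i) : ℝ) : ℂ)) +
      (M.toBlocks₂₂.map (Int.cast : ℤ → ℂ))ᵀ *ᵥ (fun i => ((u (Sum.inr i) : ℝ) : ℂ)) := by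
    ext i
    simp [mulVec, dotProduct, Fintype.sum_sum_type, toBlocks₁₂, toBlocks₂₂]
  have e2 : (fun i => ((((M.map (Int.cast : ℤ → ℝ))ᵀ *ᵥ u) (Sum.inl i) : ℝ) : ℂ)) =
      (M.toBlocks₁₁.map (Int.cast : ℤ → ℂ))ᵀ *ᵥ (fun i => ((u (Sum.inl i) : ℝ) : ℂ)) +
      (M.toBlocks₂₁.map (Int.cast : ℤ → ℂ))ᵀ *ᵥ (fun i => ((u (Sum.inr i) : ℝ) : ℂ)) := by
    ext i
    simp [mulVec, dotProduct, Fintype.sum_sum_type, toBlocks₁₁, toBlocks₂₁]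
  rw [e1, e2]
  simp only [mulVec_add, add_mulVec, mulVec_mulVec]
  abel

theorem form_mulVec_of_siegelRel {Z W : SiegelUpperHalfSpace m}
    {M : Matrix (Fin m ⊕ Fin m) (Fin m ⊕ Fin m) ℤ} (hM : M ∈ symplecticGroup (Fin m) ℤ)
    (h : W.1 * (M.toBlocks₂₁.map (Int.cast : ℤ → ℂ) * Z.1 + M.toBlocks₂₂.map (Int.cast : ℤ → ℂ)) =
      M.toBlocks₁₁.map (Int.cast : ℤ → ℂ) * Z.1 + M.toBlocks₁₂.map (Int.cast : ℤ → ℂ))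
    (u : Fin m ⊕ Fin m → ℝ) :
    Z.form ((M.map (Int.cast : ℤ → ℝ))ᵀ *ᵥ u) = W.form u := by
  obtain ⟨v, hv⟩ := W.exists_point_eq u
  have hMR : M.map (Int.cast : ℤ → ℝ) ∈ symplecticGroup (Fin m) ℝ :=
    SymplecticGroup.map_mem hM (Int.castRingHom ℝ)
  rw [SymplecticGroup.mem_iff] at hMR
  rw [W.form_eq_of_point_eq hv, Z.form_eq_of_point_eq
    (v := (M.map (Int.cast : ℤ → ℝ))ᵀ *ᵥ v)]
  · rw [← vecMul_transpose, transpose_transpose, ← dotProduct_mulVec, mulVec_mulVec, mulVec_mulVec,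
      hMR]
  · rw [point_mulVec_of_siegelRel h, point_mulVec_of_siegelRel h, hv, mulVec_smul]

theorem hasShort_iff_of_siegelRel {Z W : SiegelUpperHalfSpace m} (h : SiegelRel Z W) (k : ℕ)
    (C : ℝ) : Z.HasShort k C ↔ W.HasShort k C := by
  obtain ⟨M, hM, h⟩ := h
  have hdet : IsUnit Mᵀ.det := by rw [det_transpose]; exact SymplecticGroup.symplectic_det hM
  have hcast : ∀ v : Fin m ⊕ Fin m → ℤ, (fun j => ((Mᵀ *ᵥ v) j : ℝ)) =
      (M.map (Int.cast : ℤ → ℝ))ᵀ *ᵥ (fun j => (v j : ℝ)) := by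
    intro v; ext j; simp [mulVec, dotProduct]
  constructor
  · rintro ⟨v, hv, hC⟩
    refine ⟨fun i => (Mᵀ)⁻¹ *ᵥ v i, ?_, fun i => ?_⟩
    · refine hv.map' (Mᵀ)⁻¹.mulVecLin (LinearMap.ker_eq_bot.2 ?_)
      intro a b hab
      have := congrArg (Mᵀ *ᵥ ·) hab
      simpa only [mulVecLin_apply, mulVec_mulVec, mul_nonsing_inv _ hdet, one_mulVec] using this
    · rw [← form_mulVec_of_siegelRel hM h, ← hcast, mulVec_mulVec, mul_nonsing_inv _ hdet,
        one_mulVec]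
      exact hC i
  · rintro ⟨v, hv, hC⟩
    refine ⟨fun i => Mᵀ *ᵥ v i, ?_, fun i => ?_⟩
    · refine hv.map' Mᵀ.mulVecLin (LinearMap.ker_eq_bot.2 ?_)
      intro a b hab
      have := congrArg ((Mᵀ)⁻¹ *ᵥ ·) hab
      simpa only [mulVecLin_apply, mulVec_mulVec, nonsing_inv_mul _ hdet, one_mulVec] using this
    · rw [hcast, form_mulVec_of_siegelRel hM h]
      exact hC i

theorem HasShort.mono {Z : SiegelUpperHalfSpace m} {k l : ℕ} {C D : ℝ} (h : Z.HasShort k C)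
    (hl : l ≤ k) (hC : C ≤ D) : Z.HasShort l D := by
  obtain ⟨v, hv, h⟩ := h
  exact ⟨v ∘ Fin.castLE hl, hv.comp _ (Fin.castLE_injective hl), fun i => (h _).trans_le hC⟩

theorem continuous_re : Continuous (re : SiegelUpperHalfSpace m → _) :=
  Continuous.matrix_map (continuous_subtype_val (p := fun Z : Matrix (Fin m) (Fin m) ℂ =>
    Z.IsSymm ∧ (Z.map Complex.im).PosDef)) Complex.continuous_re

theorem continuous_im : Continuous (im : SiegelUpperHalfSpace m → _) :=
  Continuous.matrix_map (continuous_subtype_val (p := fun Z : Matrix (Fin m) (Fin m) ℂ =>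
    Z.IsSymm ∧ (Z.map Complex.im).PosDef)) Complex.continuous_im

theorem continuous_im_inv : Continuous (fun Z : SiegelUpperHalfSpace m => Z.im⁻¹) := by
  rw [continuous_iff_continuousAt]
  intro Z
  have : ContinuousAt (fun Y : Matrix (Fin m) (Fin m) ℝ => Y⁻¹) Z.im := by
    apply continuousAt_matrix_inv
    obtain ⟨d, hd⟩ := Z.isUnit_det_im
    rw [← hd]
    exact NormedRing.inverse_continuousAt d
  exact ContinuousAt.comp (f := im) this continuous_im.continuousAt

theorem continuous_form (u : Fin m ⊕ Fin m → ℝ) :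
    Continuous (fun Z : SiegelUpperHalfSpace m => Z.form u) := by
  have h1 : Continuous (fun Z : SiegelUpperHalfSpace m => Z.rePoint u) :=
    continuous_const.add (continuous_re.matrix_mulVec continuous_const)
  exact (h1.dotProduct (continuous_im_inv.matrix_mulVec h1)).add
    (continuous_const.dotProduct (continuous_im.matrix_mulVec continuous_const))

/-- The gap between `D` and `C` will absorb the error made in lifting vectors from a block to a
larger matrix. -/
theorem HasShort.eventually {Z : SiegelUpperHalfSpace m} {k : ℕ} {C : ℝ} (h : Z.HasShort k C)
    (hC : 0 < C) : ∃ D, 0 < D ∧ D < C ∧ ∀ᶠ W in 𝓝 Z, W.HasShort k D := by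
  obtain ⟨v, hv, h⟩ := h
  obtain ⟨D, hDC, h0, hD⟩ : ∃ D, D < C ∧ 0 < D ∧ ∀ i, Z.form (fun j => (v i j : ℝ)) < D := by
    have h0 : ∀ᶠ D in 𝓝[<] C, 0 < D := (eventually_gt_nhds hC).filter_mono nhdsWithin_le_nhds
    have h1 : ∀ᶠ D in 𝓝[<] C, ∀ i, Z.form (fun j => (v i j : ℝ)) < D :=
      (eventually_all.2 fun i => eventually_gt_nhds (h i)).filter_mono nhdsWithin_le_nhds
    exact ((eventually_mem_nhdsWithin (s := Set.Iio C)).and (h0.and h1)).exists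
  refine ⟨D, h0, hDC, ?_⟩
  have : ∀ᶠ W in 𝓝 Z, ∀ i, W.form (fun j => (v i j : ℝ)) < D :=
    eventually_all.2 fun i => (continuous_form _).continuousAt.eventually_lt_const (hD i)
  filter_upwards [this] with W hW using ⟨v, hv, hW⟩

end SiegelUpperHalfSpace

/-! ### Short vectors near the boundary -/

namespace SiegelUpperHalfSpace

open Matrix

variable {m : ℕ}

/-- With `s = Y⁻¹ d`, depth bounds `T` times the square of the tail of `s` by `s ⬝ Y s = d ⬝ s`, and
only that tail pairs with `d`. The arithmetic-geometric inequality then bounds `d ⬝ s` by half of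
itself plus `d ⬝ d / (2T)`. -/
theorem IsDeep.dotProduct_im_inv_le {Z : SiegelUpperHalfSpace m} {c : ℕ} {T : ℝ}
    (hZ : Z.IsDeep c T) (hT : 0 < T) {d : Fin m → ℝ} (hd : ∀ i : Fin m, (i : ℕ) < c → d i = 0) :
    d ⬝ᵥ Z.im⁻¹ *ᵥ d ≤ d ⬝ᵥ d / T := by
  set s := Z.im⁻¹ *ᵥ d with hs
  have h1 : Z.im *ᵥ s = d := Z.im_mulVec_inv_mulVec d
  have h2 := Matrix.PosDef.dotProduct_nonneg hZ s
  rw [sub_mulVec, dotProduct_sub] at h2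
  change 0 ≤ s ⬝ᵥ Z.im *ᵥ s - _ at h2
  rw [h1, dotProduct_comm s d] at h2
  have h3 : d ⬝ᵥ s ≤ (s ⬝ᵥ (Matrix.diagonal fun i : Fin m => if (i : ℕ) < c then (0 : ℝ) else T) *ᵥ s) / 2 +
      (d ⬝ᵥ d / T) / 2 := by
    simp only [dotProduct, Finset.sum_div, ← Finset.sum_add_distrib, mulVec_diagonal]
    refine Finset.sum_le_sum fun i _ => ?_
    by_cases hi : (i : ℕ) < c
    · simp [hi, hd i hi]
    · simp only [hi, if_false]
      have : d i * s i * (2 * T) ≤ (s i * (T * s i) / 2 + d i * d i / T / 2) * (2 * T) := by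
        have e : (s i * (T * s i) / 2 + d i * d i / T / 2) * (2 * T) =
          (T * s i) ^ 2 + d i ^ 2 := by field_simp
        rw [e]
        nlinarith [sq_nonneg (T * s i - d i)]
      exact le_of_mul_le_mul_right this (by positivity)
  linarith

/-- Lift of an integral vector from the upper left block, almost realising the quotient norm. -/
theorem exists_lift {k : ℕ} {Z : SiegelUpperHalfSpace (m + k)} {T : ℝ} (hZ : Z.IsDeep m T)
    (hT : 0 < T) (u : Fin m ⊕ Fin m → ℤ) :
    ∃ v : Fin (m + k) ⊕ Fin (m + k) → ℤ,
      (∀ i, v (Sum.inl (Fin.castAdd k i)) = u (Sum.inl i)) ∧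
      (∀ i, v (Sum.inr (Fin.castAdd k i)) = u (Sum.inr i)) ∧
      Z.form (fun j => (v j : ℝ)) ≤
        (Z.upperLeft (Nat.le_add_right m k)).form (fun j => (u j : ℝ)) + (m + k : ℕ) / T := by
  set Z₁ := Z.upperLeft (Nat.le_add_right m k)
  set y₁ : Fin m → ℝ := fun i => u (Sum.inl i) with hy₁
  set w₁ := Z₁.rePoint (fun j => (u j : ℝ)) with hw₁
  set s₁ := Z₁.im⁻¹ *ᵥ w₁ with hs₁
  set s : Fin (m + k) → ℝ := Fin.append s₁ 0 with hs
  set y : Fin (m + k) → ℝ := Fin.append y₁ 0 with hy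
  -- The last entries of `t` are the real coordinates for which the real part of the point would
  -- equal `Y s` exactly. Rounding them leaves an error `d` supported on the last block, with
  -- entries at most `1/2`.
  set t := Z.im *ᵥ s - Z.re *ᵥ y with ht
  have hre : ∀ i j, Z.re (Fin.castAdd k i) (Fin.castAdd k j) = Z₁.re i j := fun _ _ => rfl
  have him : ∀ i j, Z.im (Fin.castAdd k i) (Fin.castAdd k j) = Z₁.im i j := fun _ _ => rfl
  let v : Fin (m + k) ⊕ Fin (m + k) → ℤ :=
    Sum.elim (Fin.append (fun i => u (Sum.inl i)) 0)
      (Fin.append (fun i => u (Sum.inr i)) (fun j => round (t (Fin.natAdd m j))))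
  have hvy : (fun j => (v j : ℝ)) ∘ Sum.inl = y := by
    ext i
    refine Fin.addCases (fun i => ?_) (fun i => ?_) i <;> simp [v, y, y₁]
  have hims : ∀ i, (Z.im *ᵥ s) (Fin.castAdd k i) = w₁ i := by
    intro i
    have : (Z.im *ᵥ s) (Fin.castAdd k i) = (Z₁.im *ᵥ s₁) i := by
      simp [mulVec, dotProduct, Fin.sum_univ_add, s, him]
    rw [this, hs₁, im_mulVec_inv_mulVec]
  have hrey : ∀ i, (Z.re *ᵥ y) (Fin.castAdd k i) = (Z₁.re *ᵥ y₁) i := by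
    intro i
    simp [mulVec, dotProduct, Fin.sum_univ_add, y, hre]
  set d := Z.rePoint (fun j => (v j : ℝ)) - Z.im *ᵥ s with hd
  have hd1 : ∀ i, d (Fin.castAdd k i) = 0 := by
    intro i
    rw [hd, Pi.sub_apply, hims, rePoint, hvy, Pi.add_apply, hrey, hw₁, rePoint]
    simp only [v, Function.comp, Sum.elim_inr, Fin.append_left, Pi.add_apply]
    exact sub_self _
  have hd2 : ∀ j, |d (Fin.natAdd m j)| ≤ 1 / 2 := by
    intro j
    have : d (Fin.natAdd m j) = round (t (Fin.natAdd m j)) - t (Fin.natAdd m j) := by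
      have e : t (Fin.natAdd m j) = (Z.im *ᵥ s) (Fin.natAdd m j) - (Z.re *ᵥ y) (Fin.natAdd m j) :=
        rfl
      rw [hd, Pi.sub_apply, rePoint, hvy, Pi.add_apply]
      simp only [v, Function.comp, Sum.elim_inr, Fin.append_right]
      linarith
    rw [this, abs_sub_comm]
    exact abs_sub_round _
  have hdd : d ⬝ᵥ d ≤ (m + k : ℕ) := by
    have : ∀ i, d i * d i ≤ 1 := by
      intro i
      refine Fin.addCases (fun i => ?_) (fun i => ?_) i
      · simp [hd1]
      · have := hd2 i
        rw [abs_le] at this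
        nlinarith
    calc d ⬝ᵥ d ≤ ∑ _i : Fin (m + k), (1 : ℝ) := Finset.sum_le_sum fun i _ => this i
      _ = _ := by simp
  have hdi := hZ.dotProduct_im_inv_le hT (d := d) (by
    intro i hi
    have : i = Fin.castAdd k ⟨i, hi⟩ := rfl
    rw [this, hd1])
  refine ⟨v, fun i => by simp [v], fun i => by simp [v], ?_⟩
  have hw : Z.rePoint (fun j => (v j : ℝ)) = Z.im *ᵥ s + d := by rw [hd]; abel
  -- The supports are disjoint, so the cross term vanishes and the error enters only through `d ⬝
  -- Y⁻¹ d`.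
  have hsd : s ⬝ᵥ d = 0 := by
    simp [dotProduct, Fin.sum_univ_add, s, hd1]
  have e1 : s ⬝ᵥ Z.im *ᵥ s = w₁ ⬝ᵥ Z₁.im⁻¹ *ᵥ w₁ := by
    rw [dotProduct_comm w₁]
    simp only [dotProduct, Fin.sum_univ_add, s, hims, ← hs₁]
    simp
  have e2 : y ⬝ᵥ Z.im *ᵥ y = y₁ ⬝ᵥ Z₁.im *ᵥ y₁ := by
    simp [mulVec, dotProduct, Fin.sum_univ_add, y, him]
  have e3 : Z.form (fun j => (v j : ℝ)) =
      s ⬝ᵥ Z.im *ᵥ s + d ⬝ᵥ Z.im⁻¹ *ᵥ d + y ⬝ᵥ Z.im *ᵥ y := by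
    rw [form, hw, hvy, mulVec_add, inv_mulVec_im_mulVec, dotProduct_add, add_dotProduct,
      add_dotProduct, Z.im_inv_isSymm.dotProduct_mulVec_comm (Z.im *ᵥ s), inv_mulVec_im_mulVec,
      dotProduct_comm d s, hsd, dotProduct_comm (Z.im *ᵥ s)]
    ring
  have e4 : Z₁.form (fun j => (u j : ℝ)) = w₁ ⬝ᵥ Z₁.im⁻¹ *ᵥ w₁ + y₁ ⬝ᵥ Z₁.im *ᵥ y₁ := rfl
  have e5 : d ⬝ᵥ d / T ≤ (m + k : ℕ) / T := by gcongr
  linarith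

theorem IsDeep.form_single_le {k : ℕ} {Z : SiegelUpperHalfSpace (m + k)} {T : ℝ}
    (hZ : Z.IsDeep m T) (hT : 0 < T) (j : Fin k) :
    Z.form (fun i => ((Pi.single (Sum.inr (Fin.natAdd m j)) 1 :
      Fin (m + k) ⊕ Fin (m + k) → ℤ) i : ℝ)) ≤ 1 / T := by
  have h1 : (fun i => ((Pi.single (Sum.inr (Fin.natAdd m j)) 1 :
      Fin (m + k) ⊕ Fin (m + k) → ℤ) i : ℝ)) ∘ Sum.inl = 0 := by
    ext i; simp
  have h2 : (fun i => ((Pi.single (Sum.inr (Fin.natAdd m j)) 1 :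
      Fin (m + k) ⊕ Fin (m + k) → ℤ) i : ℝ)) ∘ Sum.inr = Pi.single (Fin.natAdd m j) 1 := by
    ext i; simp [Pi.single_apply]
  rw [form, rePoint, h1, h2]
  have := hZ.dotProduct_im_inv_le hT (d := Pi.single (Fin.natAdd m j) 1) (by
    intro i hi
    rw [Pi.single_eq_of_ne]
    rintro rfl
    simp at hi)
  simpa using this

/-- Each added dimension contributes one nearly vanishing vector `a_j`, and the `l` given vectors
survive as lifts. -/
theorem HasShort.of_upperLeft {k l : ℕ} {Z : SiegelUpperHalfSpace (m + k)} {C D T : ℝ}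
    (h : (Z.upperLeft (Nat.le_add_right m k)).HasShort l D) (hT : 0 < T)
    (hZ : Z.IsDeep m T) (hC : D + (m + k : ℕ) / T ≤ C) (hC' : 1 / T < C) :
    Z.HasShort (l + k) C := by
  obtain ⟨v, hv, h⟩ := h
  choose L hL1 hL2 hL3 using fun i => exists_lift hZ hT (v i)
  let w : Fin l ⊕ Fin k → (Fin (m + k) ⊕ Fin (m + k) → ℤ) :=
    Sum.elim L (fun j => Pi.single (Sum.inr (Fin.natAdd m j)) 1)
  have hw : LinearIndependent ℤ w := by
    rw [Fintype.linearIndependent_iff] at hv ⊢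
    intro a ha
    simp only [Fintype.sum_sum_type, w, Sum.elim_inl, Sum.elim_inr] at ha
    -- Restriction to the coordinates of the block kills the added vectors and turns the lifts back
    -- into `v`.
    have h0 : ∀ i, a (Sum.inl i) = 0 := by
      apply hv
      ext (j | j)
      · have := congrFun ha (Sum.inl (Fin.castAdd k j))
        simpa only [Pi.add_apply, Finset.sum_apply, Pi.smul_apply, hL1, Pi.single_apply, reduceCtorEq,
          if_false, smul_zero, Finset.sum_const_zero, add_zero, Pi.zero_apply] using this
      · have := congrFun ha (Sum.inr (Fin.castAdd k j))
        have e : ∀ i : Fin k, Fin.castAdd k j ≠ Fin.natAdd m i := fun i => by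
          simp only [ne_eq, Fin.ext_iff, Fin.val_castAdd, Fin.val_natAdd]; omega
        simpa only [Pi.add_apply, Finset.sum_apply, Pi.smul_apply, hL2, Pi.single_apply, e,
          Sum.inr.injEq,
          if_false, smul_zero, Finset.sum_const_zero, add_zero, Pi.zero_apply] using this
    rintro (i | i)
    · exact h0 i
    · have := congrFun ha (Sum.inr (Fin.natAdd m i))
      simpa only [Pi.add_apply, Finset.sum_apply, Pi.smul_apply, h0, zero_smul,
        Finset.sum_const_zero, zero_add, Pi.single_apply, Sum.inr.injEq, Fin.natAdd_inj, smul_eq_mul,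
        mul_ite, mul_one, mul_zero, Finset.sum_ite_eq, Finset.mem_univ, if_true, Pi.zero_apply]
        using this
  refine ⟨w ∘ finSumFinEquiv.symm, hw.comp _ finSumFinEquiv.symm.injective, fun i => ?_⟩
  simp only [Function.comp]
  rcases finSumFinEquiv.symm i with i | i
  · exact ((hL3 i).trans_lt (add_lt_add_left (h i) _)).trans_le hC
  · exact (hZ.form_single_le hT i).trans_lt hC'

theorem exists_hasShort (Z : SiegelUpperHalfSpace m) : ∃ C > 0, Z.HasShort (m + m) C := by
  obtain ⟨C, hC⟩ := Finite.exists_le (fun i : Fin m ⊕ Fin m =>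
    Z.form (fun j => ((Pi.single i 1 : Fin m ⊕ Fin m → ℤ) j : ℝ)))
  refine ⟨max C 0 + 1, by positivity, fun i => Pi.single (finSumFinEquiv.symm i) 1, ?_, fun i => ?_⟩
  · exact (Pi.linearIndependent_single_one (Fin m ⊕ Fin m) ℤ).comp _ finSumFinEquiv.symm.injective
  · exact (hC _).trans_lt (lt_add_of_le_of_pos (le_max_left _ _) one_pos)

end SiegelUpperHalfSpace

/-- The set of the points of the Satake–Baily–Borel compactification whose lattice, if they lie in
the stratum `A_m`, contains `f m` independent vectors of norm square less than `C`. -/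
def SatakeBB.shortSet (g : ℕ) (f : ℕ → ℕ) (C : ℝ) : Set (SatakeBB g) :=
  {x | Quot.lift (fun Z : SiegelUpperHalfSpace x.1 => Z.HasShort (f x.1) C)
    (fun _ _ h => propext (SiegelUpperHalfSpace.hasShort_iff_of_siegelRel h _ _)) x.2}

theorem SatakeBB.mk_mem_shortSet {g : ℕ} {f : ℕ → ℕ} {C : ℝ} {m : ℕ} (hm : m ≤ g)
    (Z : SiegelUpperHalfSpace m) :
    SatakeBB.mk m hm Z ∈ SatakeBB.shortSet g f C ↔ Z.HasShort (f m) C := Iff.rfl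

/-- Passing from `A_m` to nearby points of `A_(m+k)` creates `k` new short vectors, so the required
number may grow by at most `k`. -/
theorem SatakeBB.isOpen_shortSet (g : ℕ) {f : ℕ → ℕ} {C : ℝ} (hC : 0 < C)
    (hf : ∀ m k, f (m + k) ≤ f m + k) : IsOpen (SatakeBB.shortSet g f C) := by
  intro m hm Z hZ
  obtain ⟨D, hD, hDC, hW⟩ := ((SatakeBB.mk_mem_shortSet hm Z).1 hZ).eventually hC
  have h1 : Tendsto (fun T : ℝ => D + g / T) atTop (𝓝 (D + 0)) :=
    tendsto_const_nhds.add (tendsto_const_nhds.div_atTop tendsto_id)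
  have h2 : Tendsto (fun T : ℝ => 1 / T) atTop (𝓝 0) := tendsto_const_nhds.div_atTop tendsto_id
  obtain ⟨T, ⟨hT1, hT2⟩, hT⟩ := (((h1.eventually_lt_const (by simpa using hDC)).and
    (h2.eventually_lt_const hC)).and (eventually_gt_atTop 0)).exists
  refine ⟨_, hW, T, hT, fun m' hmm' hm' Z' hZ' hdeep => ?_⟩
  rw [SatakeBB.mk_mem_shortSet]
  obtain ⟨k, rfl⟩ := Nat.exists_eq_add_of_le hmm'
  refine (SiegelUpperHalfSpace.HasShort.of_upperLeft hZ' hT hdeep (le_trans ?_ hT1.le)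
    hT2).mono (hf m k) le_rfl
  have : ((m + k : ℕ) : ℝ) ≤ g := by exact_mod_cast hm'
  gcongr

/-! ### Distances in flat tori -/

namespace FlatTorus

variable {E : Type*} [NormedAddCommGroup E] (Λ : Submodule ℤ E)

/-- The class of a vector in a flat torus. -/
abbrev mk (x : E) : FlatTorus Λ := QuotientAddGroup.mk x

theorem mk_surjective : Function.Surjective (mk Λ) := QuotientAddGroup.mk_surjective

theorem mk_sub (x y : E) : mk Λ (x - y) = mk Λ x - mk Λ y := rfl

theorem mk_add (x y : E) : mk Λ (x + y) = mk Λ x + mk Λ y := rfl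

theorem norm_mk_le (x : E) : ‖mk Λ x‖ ≤ ‖x‖ := QuotientAddGroup.norm_mk_le_norm

theorem mk_eq_mk {x y : E} : mk Λ x = mk Λ y ↔ x - y ∈ Λ := by
  rw [mk, mk, eq_comm, QuotientAddGroup.eq, neg_add_eq_sub]
  rfl

theorem dist_mk [DiscreteTopology Λ] (x y : E) : dist (mk Λ x) (mk Λ y) = ‖mk Λ (x - y)‖ := by
  rw [dist_eq_norm, mk_sub]

theorem le_norm_mk_iff {x : E} {r : ℝ} : r ≤ ‖mk Λ x‖ ↔ ∀ l ∈ Λ, r ≤ ‖x - l‖ := by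
  rw [QuotientAddGroup.le_norm_iff]
  constructor
  · intro h l hl
    exact h _ ((mk_eq_mk Λ).2 (by simpa using hl))
  · intro h m hm
    have := h _ ((mk_eq_mk Λ).1 hm.symm)
    simpa using this

theorem norm_mk_le_of_mem {x l : E} (hl : l ∈ Λ) : ‖mk Λ x‖ ≤ ‖x - l‖ :=
  (le_norm_mk_iff Λ).1 le_rfl l hl

theorem exists_norm_mk_eq [ProperSpace E] [DiscreteTopology Λ] (x : E) :
    ∃ l ∈ Λ, ‖mk Λ x‖ = ‖x - l‖ := by
  obtain ⟨l, hl, h⟩ := (FlatTorus.isClosed Λ).exists_infDist_eq_dist ⟨0, Λ.zero_mem⟩ x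
  exact ⟨l, hl, by rw [mk, QuotientAddGroup.norm_mk, h, dist_eq_norm]⟩

/-- Integral parts of the coefficients can be subtracted. The bound does not depend on `t`, which is
why a whole real span collapses after rescaling. -/
theorem norm_mk_sum_smul_le [NormedSpace ℝ E] {ι : Type*} [Fintype ι] {v : ι → E}
    (hv : ∀ i, v i ∈ Λ) (t : ι → ℝ) : ‖mk Λ (∑ i, t i • v i)‖ ≤ ∑ i, ‖v i‖ := by
  have hl : ∑ i, ⌊t i⌋ • v i ∈ Λ := Λ.sum_mem fun i _ => Λ.smul_mem _ (hv i)
  refine (norm_mk_le_of_mem Λ hl).trans ?_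
  rw [← Finset.sum_sub_distrib]
  refine (norm_sum_le _ _).trans (Finset.sum_le_sum fun i _ => ?_)
  have : t i • v i - ⌊t i⌋ • v i = Int.fract (t i) • v i := by
    rw [← Int.self_sub_floor, sub_smul, Int.cast_smul_eq_zsmul]
  rw [this, norm_smul, Real.norm_of_nonneg (Int.fract_nonneg _)]
  exact mul_le_of_le_one_left (norm_nonneg _) (Int.fract_lt_one _).le

theorem diam_le [DiscreteTopology Λ] {C : ℝ} (h : ∀ x : E, ‖mk Λ x‖ ≤ C) :
    Metric.diam (Set.univ : Set (FlatTorus Λ)) ≤ C := by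
  refine Metric.diam_le_of_forall_dist_le ((norm_nonneg _).trans (h 0)) fun x _ y _ => ?_
  obtain ⟨x, rfl⟩ := mk_surjective Λ x
  obtain ⟨y, rfl⟩ := mk_surjective Λ y
  rw [dist_mk]
  exact h _

variable [NormedSpace ℝ E] [FiniteDimensional ℝ E] [DiscreteTopology Λ] [IsZLattice ℝ Λ]

theorem norm_le_diam (x : FlatTorus Λ) : ‖x‖ ≤ Metric.diam (Set.univ : Set (FlatTorus Λ)) := by
  have := Metric.dist_le_diam_of_mem (isCompact_univ (X := FlatTorus Λ)).isBounded
    (Set.mem_univ x) (Set.mem_univ 0)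
  rwa [dist_zero_right] at this

theorem exists_norm_eq_diam : ∃ x : E, ‖mk Λ x‖ = Metric.diam (Set.univ : Set (FlatTorus Λ)) := by
  obtain ⟨x, -, hx⟩ := (isCompact_univ (X := FlatTorus Λ)).exists_isMaxOn Set.univ_nonempty
    continuous_norm.continuousOn
  obtain ⟨x, rfl⟩ := mk_surjective Λ x
  exact ⟨x, le_antisymm (norm_le_diam Λ _) (diam_le Λ fun y => hx (Set.mem_univ (mk Λ y)))⟩

end FlatTorus

/-! ### Gromov–Hausdorff convergence by parametrizations -/

/-- The pairs `(p n x, q x)` form a correspondence between the two spaces whose distortion tends to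
zero. -/
theorem tendsto_toGHSpace_of_surjective {K : Type*} {X : ℕ → Type} [∀ n, MetricSpace (X n)]
    [∀ n, CompactSpace (X n)] [∀ n, Nonempty (X n)] {Y : Type} [MetricSpace Y] [CompactSpace Y]
    [Nonempty Y] {p : ∀ n, K → X n} (hp : ∀ n, Function.Surjective (p n)) {q : K → Y}
    (hq : Function.Surjective q)
    (h : ∀ ε > 0, ∀ᶠ n in atTop, ∀ x y, |dist (p n x) (p n y) - dist (q x) (q y)| ≤ ε) :
    Tendsto (fun n => GromovHausdorff.toGHSpace (X n)) atTop
      (𝓝 (GromovHausdorff.toGHSpace Y)) := by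
  rw [Metric.tendsto_nhds]
  intro ε hε
  filter_upwards [h (ε / 4) (by positivity)] with n hn
  change GromovHausdorff.ghDist (X n) Y < ε
  refine lt_of_le_of_lt (GromovHausdorff.ghDist_le_of_approx_subsets
    (s := Set.univ) (fun x => q (Function.surjInv (hp n) x.1)) (ε₁ := 0) (ε₂ := ε / 4)
    (ε₃ := ε / 4) ?_ ?_ ?_) (by linarith)
  · exact fun x => ⟨x, Set.mem_univ _, by simp⟩
  · intro y
    obtain ⟨k, rfl⟩ := hq y
    refine ⟨⟨p n k, Set.mem_univ _⟩, ?_⟩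
    -- The chosen preimage of `p n k` may differ from `k`, but both have the same image under `p n`,
    -- so their images under `q` are close.
    have := hn k (Function.surjInv (hp n) (p n k))
    rw [Function.surjInv_eq (hp n), dist_self, zero_sub, abs_neg, abs_of_nonneg dist_nonneg] at this
    exact this
  · intro x y
    have := hn (Function.surjInv (hp n) x.1) (Function.surjInv (hp n) y.1)
    rwa [Function.surjInv_eq (hp n), Function.surjInv_eq (hp n)] at this

/-! ### Limits of quotient norms of lattices -/

/-- The properties of the function `x ↦ dist(x, L)` for a closed subgroup `L` of `E` such that
`E / L` has radius at most one. -/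
structure IsTorusNorm {E : Type*} [NormedAddCommGroup E] (f : E → ℝ) : Prop where
  map_neg : ∀ x, f (-x) = f x
  add_le : ∀ x y, f (x + y) ≤ f x + f y
  exists_eq : ∀ x, ∃ y, f (x - y) = 0 ∧ ‖y‖ = f x
  le_one : ∀ x, f x ≤ 1
  le_norm : ∀ x, f x ≤ ‖x‖

namespace IsTorusNorm

section basic

variable {E : Type*} [NormedAddCommGroup E] {f : E → ℝ} (hf : IsTorusNorm f)
include hf

theorem nonneg (x : E) : 0 ≤ f x := by
  obtain ⟨y, -, hy⟩ := hf.exists_eq x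
  exact hy ▸ norm_nonneg y

theorem map_zero : f 0 = 0 := le_antisymm (by simpa using hf.le_norm 0) (hf.nonneg 0)

theorem abs_sub_le (x y : E) : |f x - f y| ≤ ‖x - y‖ := by
  have h1 := hf.add_le (x - y) y
  have h2 := hf.add_le (y - x) x
  rw [sub_add_cancel] at h1 h2
  have h3 := hf.le_norm (x - y)
  have h4 := hf.le_norm (y - x)
  rw [norm_sub_rev] at h4
  rw [abs_sub_le_iff]
  constructor <;> linarith

theorem add_eq {x y : E} (hy : f y = 0) : f (x + y) = f x := by
  have h1 := hf.add_le x y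
  have h2 := hf.add_le (x + y) (-y)
  rw [hf.map_neg, add_neg_cancel_right] at h2
  linarith

theorem sub_eq {x y : E} (hy : f y = 0) : f (x - y) = f x := by
  rw [sub_eq_add_neg]
  exact hf.add_eq (by rw [hf.map_neg, hy])

theorem nsmul_eq {x : E} (hx : f x = 0) (n : ℕ) : f (n • x) = 0 := by
  induction n with
  | zero => rw [zero_smul, hf.map_zero]
  | succ n ih => rw [succ_nsmul, hf.add_eq hx, ih]

theorem zsmul_eq {x : E} (hx : f x = 0) (n : ℤ) : f (n • x) = 0 := by
  obtain ⟨n, rfl | rfl⟩ := n.eq_nat_or_neg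
  · rw [natCast_zsmul, hf.nsmul_eq hx]
  · rw [neg_smul, hf.map_neg, natCast_zsmul, hf.nsmul_eq hx]

theorem continuous : Continuous f := by
  refine LipschitzWith.continuous (K := 1) (LipschitzWith.of_dist_le_mul fun x y => ?_)
  rw [Real.dist_eq, dist_eq_norm, NNReal.coe_one, one_mul]
  exact hf.abs_sub_le x y

end basic

theorem tendstoUniformly_closedBall {E : Type*} [NormedAddCommGroup E] [ProperSpace E]
    {f : ℕ → E → ℝ} (hf : ∀ n, IsTorusNorm (f n)) {F : E → ℝ} (hF : IsTorusNorm F)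
    (h : ∀ x, Tendsto (fun n => f n x) atTop (𝓝 (F x))) (R : ℝ) {ε : ℝ} (hε : 0 < ε) :
    ∀ᶠ n in atTop, ∀ x ∈ Metric.closedBall (0 : E) R, |f n x - F x| ≤ ε := by
  obtain ⟨t, -, ht, hcov⟩ :=
    (isCompact_closedBall (0 : E) R).finite_cover_balls (e := ε / 3) (by positivity)
  have : ∀ᶠ n in atTop, ∀ x ∈ t, |f n x - F x| < ε / 3 :=
    (eventually_all_finite ht).2 fun x _ => by
      simpa [Real.dist_eq] using (Metric.tendsto_nhds.1 (h x)) (ε / 3) (by positivity)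
  filter_upwards [this] with n hn x hx
  obtain ⟨y, hy, hxy⟩ := Set.mem_iUnion₂.1 (hcov hx)
  rw [Metric.mem_ball, dist_eq_norm] at hxy
  have h1 := (hf n).abs_sub_le x y
  have h2 := hF.abs_sub_le x y
  have h3 := hn y hy
  rw [abs_le] at h1 h2 ⊢
  rw [abs_lt] at h3
  constructor <;> linarith

/-- All conditions pass to pointwise limits directly except the existence of nearest zeros. For that
one the vectors `y n` lie in the unit ball, so a subsequence converges. -/
theorem of_tendsto {E : Type*} [NormedAddCommGroup E] [ProperSpace E]
    {f : ℕ → E → ℝ} (hf : ∀ n, IsTorusNorm (f n)) {F : E → ℝ}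
    (h : ∀ x, Tendsto (fun n => f n x) atTop (𝓝 (F x))) : IsTorusNorm F where
  map_neg x := tendsto_nhds_unique (h (-x)) (by simpa only [(hf _).map_neg] using h x)
  add_le x y := le_of_tendsto_of_tendsto' (h (x + y)) ((h x).add (h y)) fun n => (hf n).add_le x y
  le_one x := le_of_tendsto' (h x) fun n => (hf n).le_one x
  le_norm x := le_of_tendsto' (h x) fun n => (hf n).le_norm x
  exists_eq x := by
    choose y hy1 hy2 using fun n => (hf n).exists_eq x
    obtain ⟨y₀, -, φ, hφ, hy₀⟩ := (isCompact_closedBall (0 : E) 1).tendsto_subseq (x := y)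
      fun n => by simpa [hy2] using (hf n).le_one x
    refine ⟨y₀, ?_, ?_⟩
    · have h1 : Tendsto (fun n => ‖y (φ n) - y₀‖) atTop (𝓝 0) := by
        rw [← tendsto_iff_norm_sub_tendsto_zero]; exact hy₀
      refine tendsto_nhds_unique ((h (x - y₀)).comp hφ.tendsto_atTop)
        (squeeze_zero (fun n => (hf _).nonneg _) (fun n => ?_) h1)
      have := (hf (φ n)).add_le (x - y (φ n)) (y (φ n) - y₀)
      rw [hy1, zero_add, sub_add_sub_cancel] at this
      exact this.trans ((hf _).le_norm _)
    · refine tendsto_nhds_unique hy₀.norm (((h x).comp hφ.tendsto_atTop).congr fun n => ?_)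
      exact (hy2 (φ n)).symm

/-- An Arzelà–Ascoli argument: compactness of a product of intervals gives convergence on a dense
sequence, and the common Lipschitz constant extends it to all points. -/
theorem exists_subseq_tendsto {E : Type*} [NormedAddCommGroup E] [ProperSpace E]
    {f : ℕ → E → ℝ} (hf : ∀ n, IsTorusNorm (f n)) :
    ∃ φ : ℕ → ℕ, StrictMono φ ∧ ∃ F, IsTorusNorm F ∧
      ∀ x, Tendsto (fun n => f (φ n) x) atTop (𝓝 (F x)) := by
  let d : ℕ → E := TopologicalSpace.denseSeq E
  have hd : DenseRange d := TopologicalSpace.denseRange_denseSeq E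
  obtain ⟨a, -, φ, hφ, ha⟩ := (isCompact_univ_pi fun _ : ℕ => isCompact_Icc (a := (0 : ℝ))
    (b := 1)).tendsto_subseq (x := fun n k => f n (d k))
    fun n k _ => ⟨(hf n).nonneg _, (hf n).le_one _⟩
  rw [tendsto_pi_nhds] at ha
  have hcau : ∀ x, CauchySeq fun n => f (φ n) x := by
    intro x
    rw [Metric.cauchySeq_iff']
    intro ε hε
    obtain ⟨k, hk⟩ := hd.exists_dist_lt x (show 0 < ε / 3 by positivity)
    obtain ⟨N, hN⟩ := Metric.cauchySeq_iff'.1 (ha k).cauchySeq (ε / 3) (by positivity)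
    refine ⟨N, fun n hn => ?_⟩
    have h0 := hN n hn
    have h1 := (hf (φ n)).abs_sub_le x (d k)
    have h2 := (hf (φ N)).abs_sub_le x (d k)
    rw [dist_eq_norm] at hk
    rw [Real.dist_eq] at h0 ⊢
    simp only [Function.comp] at h0
    rw [abs_lt] at h0 ⊢
    rw [abs_le] at h1 h2
    constructor <;> linarith
  choose F hF using fun x => cauchySeq_tendsto_of_complete (hcau x)
  exact ⟨φ, hφ, F, of_tendsto (fun n => hf (φ n)) hF, hF⟩

section structure_theorem

variable {E : Type*} [NormedAddCommGroup E] [InnerProductSpace ℝ E]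
  {f : E → ℝ} (hf : IsTorusNorm f)

/-- The largest subspace contained in the kernel. -/
def kerSubspace : Submodule ℝ E where
  carrier := {x | ∀ t : ℝ, f (t • x) = 0}
  zero_mem' t := by rw [smul_zero, hf.map_zero]
  add_mem' {x y} hx hy t := by rw [smul_add, hf.add_eq (hy t), hx t]
  smul_mem' s x hx t := by rw [smul_smul]; exact hx _

theorem eq_zero_of_mem_kerSubspace {x : E} (hx : x ∈ hf.kerSubspace) : f x = 0 := by
  simpa using hx 1

variable [FiniteDimensional ℝ E]

/-- The zeros of `f` form a closed subgroup. Modulo the largest subspace in it, what remains is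
discrete, and it has full rank because `f` is bounded. The last clause bounds the dimension of the
torus, since the given lines all lie in that subspace. -/
theorem exists_flatTorus (hf : IsTorusNorm f) :
    ∃ (d : ℕ) (Λ : Submodule ℤ (EuclideanSpace ℝ (Fin d))) (_ : DiscreteTopology Λ)
      (_ : IsZLattice ℝ Λ) (P : E →ₗ[ℝ] EuclideanSpace ℝ (Fin d)),
      Function.Surjective P ∧ (∀ x, ‖FlatTorus.mk Λ (P x)‖ = f x) ∧
      ∀ (k : ℕ) (u : Fin k → E), Orthonormal ℝ u → (∀ i (t : ℝ), f (t • u i) = 0) →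
        d + k ≤ Module.finrank ℝ E := by
  have : ProperSpace E := FiniteDimensional.proper ℝ E
  set K := hf.kerSubspaceᗮ with hK
  let e := (stdOrthonormalBasis ℝ K).repr
  let P : E →ₗ[ℝ] EuclideanSpace ℝ (Fin (Module.finrank ℝ K)) :=
    e.toLinearEquiv.toLinearMap ∘ₗ K.orthogonalProjectionOnto.toLinearMap
  let J : EuclideanSpace ℝ (Fin (Module.finrank ℝ K)) →ₗ[ℝ] E :=
    K.subtype ∘ₗ e.symm.toLinearEquiv.toLinearMap
  have hPJ : ∀ z, P (J z) = z := by
    intro z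
    change e (K.orthogonalProjectionOnto (e.symm z : E)) = z
    rw [Submodule.orthogonalProjectionOnto_mem_subspace_eq_self, e.apply_symm_apply]
  have hJK : ∀ z, J z ∈ K := fun z => (e.symm z).2
  have hJ : ∀ z, ‖J z‖ = ‖z‖ := fun z => e.symm.norm_map z
  have hP : ∀ x, ‖P x‖ ≤ ‖x‖ := by
    intro x
    change ‖e (K.orthogonalProjectionOnto x)‖ ≤ ‖x‖
    rw [e.norm_map]
    exact K.norm_orthogonalProjectionOnto_apply_le x
  have hJP : ∀ x, x - J (P x) ∈ hf.kerSubspace := by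
    intro x
    have : J (P x) = K.starProjection x := by
      change (e.symm (e (K.orthogonalProjectionOnto x)) : E) = _
      rw [e.symm_apply_apply]
      rfl
    rw [this]
    have h2 : Kᗮ = hf.kerSubspace := Submodule.orthogonal_orthogonal _
    exact h2.le (K.sub_starProjection_mem_orthogonal x)
  have hfJP : ∀ x, f (J (P x)) = f x := by
    intro x
    have := hf.sub_eq (x := x) (hf.eq_zero_of_mem_kerSubspace (hJP x))
    rwa [sub_sub_cancel] at this
  let Λ : Submodule ℤ (EuclideanSpace ℝ (Fin (Module.finrank ℝ K))) :=
    { carrier := {z | f (J z) = 0}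
      zero_mem' := by simp [hf.map_zero]
      add_mem' := fun {x y} hx hy => by
        change f (J (x + y)) = 0
        rw [map_add, hf.add_eq hy, hx]
      smul_mem' := fun n x hx => by
        change f (J (n • x)) = 0
        rw [map_zsmul, hf.zsmul_eq hx] }
  have hmem : ∀ z, z ∈ Λ ↔ f (J z) = 0 := fun _ => Iff.rfl
  have hex : ∀ z, ∃ l ∈ Λ, ‖z - l‖ ≤ f (J z) := by
    intro z
    obtain ⟨y, hy, hy'⟩ := hf.exists_eq (J z)
    refine ⟨z - P y, ?_, ?_⟩
    · rw [hmem, map_sub]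
      have e1 : J z - J (P y) = (J z - y) + (y - J (P y)) := by abel
      rw [e1, hf.add_eq (hf.eq_zero_of_mem_kerSubspace (hJP y)), hy]
    · rw [sub_sub_cancel, ← hy']
      exact hP y
  -- If nonzero elements of `Λ` tended to zero, their directions would accumulate at a unit vector
  -- `u`. Integral multiples of short vectors are dense in the limit line, so that line would lie in
  -- the kernel subspace, to which `J u` is orthogonal.
  have hsmall : ∃ δ > 0, ∀ z ∈ Λ, z ≠ 0 → δ ≤ ‖z‖ := by
    by_contra! hcon
    choose z hz hz0 hzn using fun n : ℕ => hcon (1 / ((n : ℝ) + 1)) (by positivity)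
    obtain ⟨u, hu, φ, hφ, hlim⟩ :=
      (isCompact_sphere (0 : EuclideanSpace ℝ (Fin (Module.finrank ℝ K))) 1).tendsto_subseq
        (x := fun n => ‖z n‖⁻¹ • z n) fun n => by
          simp [norm_smul, hz0 n]
    have hz1 : Tendsto (fun n => ‖z (φ n)‖) atTop (𝓝 0) :=
      (squeeze_zero (fun n => norm_nonneg _) (fun n => (hzn n).le)
        tendsto_one_div_add_atTop_nhds_zero_nat).comp hφ.tendsto_atTop
    have hker : J u ∈ hf.kerSubspace := by
      intro t
      have hc : Continuous fun v => f (t • J v) :=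
        hf.continuous.comp ((LinearMap.continuous_of_finiteDimensional J).const_smul t)
      refine tendsto_nhds_unique ((hc.tendsto u).comp hlim)
        (squeeze_zero (fun n => hf.nonneg _) (fun n => ?_) hz1)
      set w := z (φ n)
      have e1 : t • J (‖w‖⁻¹ • w) = Int.fract (t * ‖w‖⁻¹) • J w + ⌊t * ‖w‖⁻¹⌋ • J w := by
        rw [← Int.cast_smul_eq_zsmul ℝ, ← add_smul, Int.fract_add_floor, map_smul, smul_smul]
      simp only [Function.comp]
      change f (t • J (‖w‖⁻¹ • w)) ≤ ‖w‖
      rw [e1, hf.add_eq (hf.zsmul_eq (hz (φ n)) _)]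
      refine (hf.le_norm _).trans ?_
      rw [norm_smul, hJ, Real.norm_of_nonneg (Int.fract_nonneg _)]
      exact mul_le_of_le_one_left (norm_nonneg _) (Int.fract_lt_one _).le
    have h0 : J u = 0 := by
      have := Submodule.inner_right_of_mem_orthogonal hker (hJK u)
      exact inner_self_eq_zero.1 this
    have : ‖u‖ = 1 := by simpa using hu
    rw [← hJ, h0, norm_zero] at this
    exact zero_ne_one this
  have hdisc : DiscreteTopology Λ := by
    obtain ⟨δ, hδ, h⟩ := hsmall
    exact DiscreteTopology.of_forall_le_norm hδ fun x hx =>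
      h x x.2 (by simpa using hx)
  -- A vector orthogonal to `Λ`, rescaled to length two, would be at distance at least two from `Λ`,
  -- while `f` is at most one.
  have hlat : IsZLattice ℝ Λ := by
    refine ⟨?_⟩
    rw [← Submodule.orthogonal_eq_bot_iff, Submodule.eq_bot_iff]
    intro z hz
    by_contra hne
    have hpos : 0 < ‖z‖ := norm_pos_iff.2 hne
    obtain ⟨l, hl, hle⟩ := hex ((2 / ‖z‖) • z)
    have h1 : inner ℝ l z = 0 := Submodule.inner_right_of_mem_orthogonal
      (Submodule.subset_span hl) hz
    have h2 : inner ℝ ((2 / ‖z‖) • z - l) z = 2 * ‖z‖ := by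
      rw [inner_sub_left, h1, inner_smul_left, real_inner_self_eq_norm_sq]
      simp
      field_simp
    have h3 := real_inner_le_norm ((2 / ‖z‖) • z - l) z
    have h4 := hle.trans (hf.le_one _)
    rw [h2] at h3
    nlinarith
  refine ⟨_, Λ, hdisc, hlat, P, fun z => ⟨J z, hPJ z⟩, fun x => ?_, fun k u hu hu0 => ?_⟩
  · apply le_antisymm
    · obtain ⟨l, hl, h⟩ := hex (P x)
      rw [hfJP] at h
      exact (FlatTorus.norm_mk_le_of_mem Λ hl).trans h
    · rw [FlatTorus.le_norm_mk_iff]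
      intro l hl
      rw [← hfJP, ← hf.sub_eq hl, ← map_sub, ← hJ]
      exact hf.le_norm _
  · have h1 : _ + Module.finrank ℝ K = _ := hf.kerSubspace.finrank_add_finrank_orthogonal
    have h2 : k ≤ Module.finrank ℝ hf.kerSubspace := by
      have hli : LinearIndependent ℝ (fun i => (⟨u i, hu0 i⟩ : hf.kerSubspace)) :=
        LinearIndependent.of_comp hf.kerSubspace.subtype hu.linearIndependent
      simpa using hli.fintype_card_le_finrank
    omega

end structure_theorem

end IsTorusNorm

/-! ### Period matrices and lattice vectors -/

section period

open Matrix

variable {g : ℕ} {V : Type*} [NormedAddCommGroup V] [InnerProductSpace ℂ V]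

/-- The vectors `a`, `b` satisfy the relations of a symplectic basis with period matrix `Z`. -/
structure IsPeriodFrame (Z : SiegelUpperHalfSpace g) (a b : Fin g → V) : Prop where
  im_inner_left : ∀ i j, (inner ℂ (a i) (a j) : ℂ).im = 0
  im_inner : ∀ i j, (inner ℂ (a i) (b j) : ℂ).im = if i = j then 1 else 0
  eq_sum : ∀ j, b j = ∑ i, Z.1 i j • a i

variable {Z : SiegelUpperHalfSpace g} {a b : Fin g → V} (h : IsPeriodFrame Z a b)
include h

/-- Substituting `b = Z a` into `Im H(a_i, b_j) = δ_ij` says that the real Gram matrix of `a` times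
`Im Z` is the identity. -/
theorem IsPeriodFrame.inner_left (i j : Fin g) :
    inner ℂ (a i) (a j) = ((Z.im⁻¹ i j : ℝ) : ℂ) := by
  have hG : (Matrix.of fun i j => (inner ℂ (a i) (a j) : ℂ).re) * Z.im = 1 := by
    ext i j
    rw [Matrix.one_apply, ← h.im_inner i j, h.eq_sum, inner_sum, Complex.im_sum, Matrix.mul_apply]
    refine Finset.sum_congr rfl fun k _ => ?_
    rw [inner_smul_right, Complex.mul_im, h.im_inner_left, mul_zero, zero_add, mul_comm]
    rfl
  rw [Matrix.inv_eq_left_inv hG]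
  exact Complex.ext (by simp) (by simp [h.im_inner_left])

theorem IsPeriodFrame.sum_eq (u : Fin g ⊕ Fin g → ℝ) :
    ∑ i, u (Sum.inr i) • a i + ∑ j, u (Sum.inl j) • b j = ∑ i, Z.point u i • a i := by
  have h1 : ∑ j, u (Sum.inl j) • b j = ∑ i, (Z.1 *ᵥ fun j => (u (Sum.inl j) : ℂ)) i • a i := by
    simp only [h.eq_sum, Finset.smul_sum, mulVec, dotProduct, Finset.sum_smul]
    rw [Finset.sum_comm]
    refine Finset.sum_congr rfl fun i _ => Finset.sum_congr rfl fun j _ => ?_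
    rw [← Complex.coe_smul, smul_smul, mul_comm]
  rw [h1, ← Finset.sum_add_distrib]
  refine Finset.sum_congr rfl fun i _ => ?_
  rw [← Complex.coe_smul, ← add_smul]
  rfl

theorem IsPeriodFrame.norm_sq_eq_form (u : Fin g ⊕ Fin g → ℝ) :
    ‖∑ i, u (Sum.inr i) • a i + ∑ j, u (Sum.inl j) • b j‖ ^ 2 = Z.form u := by
  have hz : (fun i => (Z.point u i).im) = Z.im *ᵥ (u ∘ Sum.inl) := funext fun i => Z.point_im u i
  have hz' : (fun i => (Z.point u i).re) = Z.rePoint u := funext fun i => Z.point_re u i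
  have e : Z.form u = Z.rePoint u ⬝ᵥ Z.im⁻¹ *ᵥ Z.rePoint u +
      (Z.im *ᵥ (u ∘ Sum.inl)) ⬝ᵥ Z.im⁻¹ *ᵥ (Z.im *ᵥ (u ∘ Sum.inl)) := by
    rw [Z.inv_mulVec_im_mulVec, dotProduct_comm (Z.im *ᵥ _)]
    rfl
  rw [e, ← hz, ← hz', h.sum_eq, ← inner_self_eq_norm_sq (𝕜 := ℂ), sum_inner]
  simp only [inner_sum, inner_smul_left, inner_smul_right, h.inner_left, dotProduct, mulVec,
    Finset.mul_sum, ← Finset.sum_add_distrib, map_sum]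
  refine Finset.sum_congr rfl fun i _ => Finset.sum_congr rfl fun j _ => ?_
  simp
  ring

theorem IsPeriodFrame.norm_sq_sum_eq_form (u : Fin g ⊕ Fin g → ℝ) :
    ‖∑ i, u i • Sum.elim b a i‖ ^ 2 = Z.form u := by
  rw [← h.norm_sq_eq_form, Fintype.sum_sum_type, add_comm]
  rfl

theorem IsPeriodFrame.exists_short (hli : LinearIndependent ℝ (Sum.elim b a)) {Λ : Submodule ℤ V}
    (ha : ∀ i, a i ∈ Λ) (hb : ∀ i, b i ∈ Λ) {k : ℕ} {C : ℝ} (hZ : Z.HasShort k C) :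
    ∃ v : Fin k → V, LinearIndependent ℝ v ∧ (∀ i, v i ∈ Λ) ∧ ∀ i, ‖v i‖ ^ 2 < C := by
  obtain ⟨v, hv, hC⟩ := hZ
  have hvR : LinearIndependent ℝ (fun i => (fun j => (v i j : ℝ))) := by
    have := (linearIndependent_algebraMap_comp_iff (R := ℤ) (S := ℝ)).2 hv
    simpa only [Function.comp_def, eq_intCast] using this
  refine ⟨fun i => Fintype.linearCombination ℝ (Sum.elim b a) (fun j => (v i j : ℝ)),
    hvR.map' _ (LinearMap.ker_eq_bot.2 hli.fintypeLinearCombination_injective),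
    fun i => ?_, fun i => ?_⟩
  · simp only [Fintype.linearCombination_apply]
    refine Λ.sum_mem fun j _ => ?_
    rw [Int.cast_smul_eq_zsmul]
    refine Λ.smul_mem _ ?_
    rcases j with j | j
    exacts [hb j, ha j]
  · simp only [Fintype.linearCombination_apply]
    rw [h.norm_sq_sum_eq_form]
    exact hC i

end period

/-! ### Short lattice vectors and the diameter -/

namespace PPAV

variable {g : ℕ} (A : PPAV g)

theorem HasPeriodMatrix.exists_short {A : PPAV g} {Z : SiegelUpperHalfSpace g}
    (hA : A.HasPeriodMatrix Z) {k : ℕ} {C : ℝ} (hZ : Z.HasShort k C) :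
    ∃ v : Fin k → A.V, LinearIndependent ℝ v ∧ (∀ i, v i ∈ A.Λ) ∧ ∀ i, ‖v i‖ ^ 2 < C := by
  obtain ⟨e, h1, -, h2, h3⟩ := hA
  have hf : IsPeriodFrame Z (fun i => (e (.inl i) : A.V)) (fun i => (e (.inr i) : A.V)) :=
    ⟨h1, h2, h3⟩
  refine hf.exists_short ?_ (fun i => (e _).2) (fun i => (e _).2) hZ
  -- The coordinates `u = (y, x)` list the coefficients of `b` first, while the symplectic basis
  -- lists `a` first.
  have := (e.ofZLatticeBasis ℝ A.Λ).linearIndependent.comp Sum.swap Sum.swap_leftInverse.injective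
  have heq : Sum.elim (fun i => (e (.inr i) : A.V)) (fun i => (e (.inl i) : A.V)) =
      e.ofZLatticeBasis ℝ A.Λ ∘ Sum.swap := by
    ext i
    rcases i with i | i <;> simp [e.ofZLatticeBasis_apply ℝ A.Λ]
  rw [heq]
  exact this

/-- The diameter of a principally polarized abelian variety. -/
noncomputable def diam : ℝ := Metric.diam (Set.univ : Set A.torus)

/-- The function `Im H(v, ·)` is `‖v‖`-Lipschitz and integral on the lattice. At `x = i v / (2‖v‖²)`
it equals `1/2`, so `x` stays at distance at least `1 / (2‖v‖)` from every lattice vector. -/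
theorem one_div_le_diam {v : A.V} (hv : v ∈ A.Λ) (hv0 : v ≠ 0) : 1 / (2 * ‖v‖) ≤ A.diam := by
  have hpos : 0 < ‖v‖ := norm_pos_iff.2 hv0
  let x : A.V := ((1 / (2 * ‖v‖ ^ 2) : ℝ) : ℂ) • (Complex.I • v)
  refine le_trans ?_ (FlatTorus.norm_le_diam A.Λ (FlatTorus.mk A.Λ x))
  rw [FlatTorus.le_norm_mk_iff]
  intro l hl
  obtain ⟨n, hn⟩ := A.integral v hv l hl
  have h1 : (inner ℂ v (x - l) : ℂ).im = 1 / 2 - n := by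
    rw [inner_sub_right, Complex.sub_im, hn, inner_smul_right, inner_smul_right,
      inner_self_eq_norm_sq_to_K]
    congr 1
    have : ((1 / (2 * ‖v‖ ^ 2) : ℝ) : ℂ) * (Complex.I * ((‖v‖ : ℝ) : ℂ) ^ 2) =
        ((1 / (2 * ‖v‖ ^ 2) * ‖v‖ ^ 2 : ℝ) : ℂ) * Complex.I := by push_cast; ring
    refine (congrArg Complex.im this).trans ?_
    rw [Complex.im_ofReal_mul, Complex.I_im]
    field_simp
  have h2 : 1 / 2 ≤ |(1 / 2 - n : ℝ)| := by
    rcases le_or_gt n 0 with hn | hn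
    · have : (n : ℝ) ≤ 0 := by exact_mod_cast hn
      exact le_abs.2 (Or.inl (by linarith))
    · have : (1 : ℝ) ≤ n := by exact_mod_cast hn
      exact le_abs.2 (Or.inr (by linarith))
  have h3 : |(inner ℂ v (x - l) : ℂ).im| ≤ ‖v‖ * ‖x - l‖ :=
    (Complex.abs_im_le_norm _).trans (norm_inner_le_norm _ _)
  rw [h1] at h3
  rw [div_le_iff₀ (by positivity)]
  linarith

theorem diam_pos (hg : 0 < g) : 0 < A.diam := by
  have hne : ∃ v ∈ A.Λ, v ≠ 0 := by
    by_contra! hcon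
    have h1 : A.Λ = ⊥ := (Submodule.eq_bot_iff _).2 hcon
    have h2 := A.isZLattice.span_top
    rw [h1, Submodule.bot_coe, Submodule.span_zero_singleton] at h2
    have : Subsingleton A.V := (Submodule.subsingleton_iff ℝ).1 (subsingleton_of_bot_eq_top h2)
    have h3 := A.finrank_eq
    rw [Module.finrank_zero_of_subsingleton] at h3
    omega
  obtain ⟨v, hv, hv0⟩ := hne
  have := norm_pos_iff.2 hv0
  exact (by positivity : 0 < 1 / (2 * ‖v‖)).trans_le (A.one_div_le_diam hv hv0)

end PPAV

/-! ### Normalized tori as functions on a fixed Euclidean space, and their limits -/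

namespace PPAV

variable {g : ℕ}

/-- The real inner product on the tangent space. -/
noncomputable instance innerProductSpaceReal (A : PPAV g) : InnerProductSpace ℝ A.V :=
  InnerProductSpace.complexToReal

theorem finrank_real (A : PPAV g) : Module.finrank ℝ A.V = 2 * g := by
  rw [finrank_real_of_complex, A.finrank_eq]

/-- Isometric coordinates on the tangent space. -/
noncomputable def coord (A : PPAV g) : A.V ≃ₗᵢ[ℝ] EuclideanSpace ℝ (Fin (2 * g)) :=
  ((stdOrthonormalBasis ℝ A.V).reindex (finCongr A.finrank_real)).repr

/-- The parametrization of the torus by the coordinate space, which is an isometry up to the factor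
`A.diam`. -/
noncomputable def param (A : PPAV g) (x : EuclideanSpace ℝ (Fin (2 * g))) : A.torus :=
  FlatTorus.mk A.Λ (A.diam • A.coord.symm x)

theorem param_add (A : PPAV g) (x y : EuclideanSpace ℝ (Fin (2 * g))) :
    A.param (x + y) = A.param x + A.param y := by
  rw [param, map_add, smul_add, FlatTorus.mk_add]; rfl

theorem param_neg (A : PPAV g) (x : EuclideanSpace ℝ (Fin (2 * g))) :
    A.param (-x) = -A.param x := by
  rw [param, map_neg, smul_neg]; rfl

theorem param_sub (A : PPAV g) (x y : EuclideanSpace ℝ (Fin (2 * g))) :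
    A.param (x - y) = A.param x - A.param y := by
  rw [sub_eq_add_neg, param_add, param_neg, sub_eq_add_neg]

/-- Subtracting a nearest lattice vector gives a preimage of least norm. In particular the closed
unit ball already covers the torus. -/
theorem exists_param_eq (A : PPAV g) (hg : 0 < g) (z : A.torus) :
    ∃ x, A.param x = z ∧ ‖x‖ = ‖z‖ / A.diam := by
  have hD := A.diam_pos hg
  obtain ⟨z, rfl⟩ := FlatTorus.mk_surjective A.Λ z
  have : ProperSpace A.V := FiniteDimensional.proper ℝ A.V
  obtain ⟨l, hl, h⟩ := FlatTorus.exists_norm_mk_eq A.Λ z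
  refine ⟨A.coord (A.diam⁻¹ • (z - l)), ?_, ?_⟩
  · rw [param, LinearIsometryEquiv.symm_apply_apply, smul_inv_smul₀ hD.ne', FlatTorus.mk_eq_mk]
    simpa using hl
  · rw [LinearIsometryEquiv.norm_map, norm_smul, h, norm_inv, Real.norm_of_nonneg hD.le]
    field_simp

/-- The quotient norm of the normalized torus as a function on the coordinate space. -/
noncomputable def torusNorm (A : PPAV g) (x : EuclideanSpace ℝ (Fin (2 * g))) : ℝ :=
  ‖A.param x‖ / A.diam

theorem isTorusNorm (A : PPAV g) (hg : 0 < g) : IsTorusNorm A.torusNorm where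
  map_neg x := by rw [torusNorm, param_neg, norm_neg, torusNorm]
  add_le x y := by
    rw [torusNorm, torusNorm, torusNorm, param_add, ← add_div]
    exact div_le_div_of_nonneg_right (norm_add_le _ _) (A.diam_pos hg).le
  exists_eq x := by
    obtain ⟨y, hy, hy'⟩ := A.exists_param_eq hg (A.param x)
    refine ⟨y, ?_, hy'⟩
    rw [torusNorm, param_sub, hy, sub_self, norm_zero, zero_div]
  le_one x := (div_le_one (A.diam_pos hg)).2 (FlatTorus.norm_le_diam _ _)
  le_norm x := by
    rw [torusNorm, div_le_iff₀ (A.diam_pos hg)]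
    refine (FlatTorus.norm_mk_le _ _).trans ?_
    rw [norm_smul, LinearIsometryEquiv.norm_map, Real.norm_of_nonneg (A.diam_pos hg).le, mul_comm]

theorem exists_torusNorm_eq_one (A : PPAV g) (hg : 0 < g) :
    ∃ x, ‖x‖ = 1 ∧ A.torusNorm x = 1 := by
  obtain ⟨z, hz⟩ := FlatTorus.exists_norm_eq_diam A.Λ
  obtain ⟨x, hx, hx'⟩ := A.exists_param_eq hg (FlatTorus.mk A.Λ z)
  have : ‖FlatTorus.mk A.Λ z‖ / A.diam = 1 := by
    rw [hz]; exact div_self (A.diam_pos hg).ne'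
  exact ⟨x, hx'.trans this, by rw [torusNorm, hx, this]⟩

/-- Short lattice vectors span directions in which the normalized torus is small. -/
theorem exists_orthonormal (A : PPAV g) (hg : 0 < g) {k : ℕ} {v : Fin k → A.V}
    (hv : LinearIndependent ℝ v) (hΛ : ∀ i, v i ∈ A.Λ) {C : ℝ} (hC : ∀ i, ‖v i‖ ≤ C) :
    ∃ u : Fin k → EuclideanSpace ℝ (Fin (2 * g)), Orthonormal ℝ u ∧
      ∀ i (t : ℝ), A.torusNorm (t • u i) ≤ k * C / A.diam := by
  let W := Submodule.span ℝ (Set.range v)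
  have hW : Module.finrank ℝ W = k := by
    simpa using finrank_span_eq_card hv
  let b := (stdOrthonormalBasis ℝ W).reindex (finCongr hW)
  refine ⟨fun i => A.coord (b i : A.V), ?_, fun i t => ?_⟩
  · exact (b.orthonormal.comp_linearIsometry W.subtypeₗᵢ).comp_linearIsometry
      A.coord.toLinearIsometry
  · refine div_le_div_of_nonneg_right ?_ (A.diam_pos hg).le
    rw [param, map_smul, LinearIsometryEquiv.symm_apply_apply, smul_smul]
    -- Every multiple of `b i` is a real combination of the `v j`, and reduction of the coefficients
    -- modulo one bounds it uniformly in `t`.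
    obtain ⟨c, hc⟩ := (Submodule.mem_span_range_iff_exists_fun ℝ).1
      (W.smul_mem (A.diam * t) (b i).2)
    rw [← hc]
    refine (FlatTorus.norm_mk_sum_smul_le A.Λ hΛ c).trans
      ((Finset.sum_le_sum fun i _ => hC i).trans ?_)
    simp

/-- The count `m + c` asks for `2c` vectors at `p`, a full basis of its lattice, and for `g + c`
vectors in the open stratum. -/
theorem ConvergesTo.exists_bound {A : ℕ → PPAV g} {c : ℕ} (hc : c < g) {p : SiegelUpperHalfSpace c}
    (hA : ConvergesTo A (SatakeBB.mk c hc.le p)) :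
    ∃ C, ∀ᶠ n in atTop, ∃ v : Fin (g + c) → (A n).V, LinearIndependent ℝ v ∧
      (∀ i, v i ∈ (A n).Λ) ∧ ∀ i, ‖v i‖ ≤ C := by
  obtain ⟨Z, hZ, hlim⟩ := hA
  obtain ⟨C, hC, hp⟩ := p.exists_hasShort
  have hO := SatakeBB.isOpen_shortSet g (f := fun m => m + c) hC (fun m k => by omega)
  have hmem : SatakeBB.mk c hc.le p ∈ SatakeBB.shortSet g (fun m => m + c) C := hp
  refine ⟨√C, (hlim.eventually (hO.mem_nhds hmem)).mono fun n hn => ?_⟩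
  obtain ⟨v, h1, h2, h3⟩ := (hZ n).exists_short (k := g + c) (C := C) hn
  exact ⟨v, h1, h2, fun i => Real.le_sqrt_of_sq_le (h3 i).le⟩

theorem ConvergesTo.tendsto_diam {A : ℕ → PPAV g} {c : ℕ} (hc : c < g)
    {p : SiegelUpperHalfSpace c} (hA : ConvergesTo A (SatakeBB.mk c hc.le p)) :
    Tendsto (fun n => (A n).diam) atTop atTop := by
  obtain ⟨Z, hZ, hlim⟩ := hA
  rw [tendsto_atTop]
  intro B
  set C := 1 / (2 * (|B| + 1)) with hC
  have hCpos : 0 < C := by positivity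
  -- By truncated subtraction this count is zero on every boundary stratum and one on `A_g`. The
  -- condition is therefore empty at `p` for every `C`, yet forces one short vector nearby.
  have hO := SatakeBB.isOpen_shortSet g (f := fun m => m - (g - 1)) (C := C ^ 2) (by positivity)
    (fun m k => by omega)
  have hmem : SatakeBB.mk c hc.le p ∈ SatakeBB.shortSet g (fun m => m - (g - 1)) (C ^ 2) := by
    rw [SatakeBB.mk_mem_shortSet, Nat.sub_eq_zero_of_le (by omega)]
    exact ⟨Fin.elim0, linearIndependent_empty_type, fun i => i.elim0⟩
  refine (hlim.eventually (hO.mem_nhds hmem)).mono fun n hn => ?_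
  replace hn : (Z n).HasShort (g - (g - 1)) (C ^ 2) := hn
  rw [show g - (g - 1) = 1 by omega] at hn
  obtain ⟨v, h1, h2, h3⟩ := (hZ n).exists_short hn
  have hpos := norm_pos_iff.2 (h1.ne_zero 0)
  refine le_trans ?_ ((A n).one_div_le_diam (h2 0) (h1.ne_zero 0))
  have h4 : ‖v 0‖ < C := lt_of_pow_lt_pow_left₀ 2 hCpos.le (h3 0)
  rw [hC, lt_div_iff₀ (by positivity)] at h4
  rw [le_div_iff₀ (by positivity)]
  nlinarith [le_abs_self B]

/-- Besides the norms, the orthonormal frames of the collapsing directions are made to converge. The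
bound on these lines is a constant over the diameter, so the limit function vanishes on the limit
lines. -/
theorem ConvergesTo.exists_subseq {A : ℕ → PPAV g} {c : ℕ} (hc : c < g)
    {p : SiegelUpperHalfSpace c} (hA : ConvergesTo A (SatakeBB.mk c hc.le p)) :
    ∃ φ : ℕ → ℕ, StrictMono φ ∧ ∃ F, IsTorusNorm F ∧
      (∀ x, Tendsto (fun n => (A (φ n)).torusNorm x) atTop (𝓝 (F x))) ∧
      ∃ u : Fin (g + c) → EuclideanSpace ℝ (Fin (2 * g)), Orthonormal ℝ u ∧
        ∀ i (t : ℝ), F (t • u i) = 0 := by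
  have hg : 0 < g := by omega
  obtain ⟨C, hC⟩ := hA.exists_bound hc
  obtain ⟨N, hN⟩ := eventually_atTop.1 hC
  obtain ⟨φ, hφ, F, hF, hlim⟩ := IsTorusNorm.exists_subseq_tendsto
    (f := fun n => (A (n + N)).torusNorm) fun n => (A _).isTorusNorm hg
  have hu : ∀ n, ∃ u : Fin (g + c) → EuclideanSpace ℝ (Fin (2 * g)), Orthonormal ℝ u ∧
      ∀ i (t : ℝ), (A (φ n + N)).torusNorm (t • u i) ≤ (g + c : ℕ) * C / (A (φ n + N)).diam := by
    intro n
    obtain ⟨v, h1, h2, h3⟩ := hN (φ n + N) (Nat.le_add_left _ _)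
    exact (A _).exists_orthonormal hg h1 h2 h3
  choose u hu1 hu2 using hu
  obtain ⟨u₀, -, ψ, hψ, hu₀⟩ := (isCompact_univ_pi fun _ : Fin (g + c) =>
    isCompact_closedBall (0 : EuclideanSpace ℝ (Fin (2 * g))) 1).tendsto_subseq (x := u)
    fun n i _ => by simp [(hu1 n).1 i]
  rw [tendsto_pi_nhds] at hu₀
  have hstrict : StrictMono fun n => φ (ψ n) + N := fun a b hab => by
    have := hφ (hψ hab)
    simpa using this
  have hlim' : ∀ x, Tendsto (fun n => (A (φ (ψ n) + N)).torusNorm x) atTop (𝓝 (F x)) :=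
    fun x => (hlim x).comp hψ.tendsto_atTop
  refine ⟨_, hstrict, F, hF, hlim', u₀, ?_, fun i t => ?_⟩
  · rw [orthonormal_iff_ite]
    intro i j
    refine tendsto_nhds_unique ((hu₀ i).inner (hu₀ j)) ?_
    refine tendsto_const_nhds.congr fun n => ?_
    exact (orthonormal_iff_ite.1 (hu1 (ψ n)) i j).symm
  · have h1 : Tendsto (fun n => (g + c : ℕ) * C / (A (φ (ψ n) + N)).diam) atTop (𝓝 0) :=
      tendsto_const_nhds.div_atTop ((hA.tendsto_diam hc).comp hstrict.tendsto_atTop)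
    have h2 : Tendsto (fun n => ‖t • u₀ i - t • u (ψ n) i‖) atTop (𝓝 0) := by
      have : Tendsto (fun n => t • u₀ i - t • u (ψ n) i) atTop (𝓝 (t • u₀ i - t • u₀ i)) :=
        tendsto_const_nhds.sub ((hu₀ i).const_smul t)
      simpa using this.norm
    have h3 := h1.add h2
    rw [add_zero] at h3
    refine tendsto_nhds_unique (hlim' (t • u₀ i))
      (squeeze_zero (fun n => ((A _).isTorusNorm hg).nonneg _) (fun n => ?_) h3)
    have h4 := (abs_le.1 (((A (φ (ψ n) + N)).isTorusNorm hg).abs_sub_le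
      (t • u₀ i) (t • u (ψ n) i))).2
    have h5 := hu2 (ψ n) i t
    linarith

/-- The normalized tori converge if their quotient norms converge pointwise to that of a torus. -/
theorem gHTendsto_of_tendsto_torusNorm {A : ℕ → PPAV g} (hg : 0 < g)
    {F : EuclideanSpace ℝ (Fin (2 * g)) → ℝ} (hF : IsTorusNorm F)
    (hlim : ∀ x, Tendsto (fun n => (A n).torusNorm x) atTop (𝓝 (F x))) {d : ℕ}
    (Λ : Submodule ℤ (EuclideanSpace ℝ (Fin d))) [DiscreteTopology Λ] [IsZLattice ℝ Λ]
    {P : EuclideanSpace ℝ (Fin (2 * g)) →ₗ[ℝ] EuclideanSpace ℝ (Fin d)}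
    (hP : Function.Surjective P) (hPF : ∀ x, ‖FlatTorus.mk Λ (P x)‖ = F x) :
    GHTendsto A (FlatTorus Λ) := by
  let K := Metric.closedBall (0 : EuclideanSpace ℝ (Fin (2 * g))) 1
  refine tendsto_toGHSpace_of_surjective (K := K) (p := fun n x => (A n).param x)
    (q := fun x => FlatTorus.mk Λ (P x)) ?_ ?_ ?_
  · intro n z
    obtain ⟨x, hx, hx'⟩ := (A n).exists_param_eq hg z
    refine ⟨⟨x, ?_⟩, hx⟩
    rw [mem_closedBall_zero_iff, hx']
    exact (div_le_one ((A n).diam_pos hg)).2 (FlatTorus.norm_le_diam _ _)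
  · intro z
    obtain ⟨z, rfl⟩ := FlatTorus.mk_surjective Λ z
    obtain ⟨x, rfl⟩ := hP z
    obtain ⟨y, hy, hy'⟩ := hF.exists_eq x
    refine ⟨⟨y, by rw [mem_closedBall_zero_iff, hy']; exact hF.le_one x⟩, ?_⟩
    rw [← hPF, map_sub, FlatTorus.mk_sub, norm_eq_zero, sub_eq_zero] at hy
    exact hy.symm
  · intro ε hε
    -- Distances are norms of differences, and differences of points of the unit ball lie in the
    -- ball of radius two.
    filter_upwards [IsTorusNorm.tendstoUniformly_closedBall (fun n => (A n).isTorusNorm hg) hF hlim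
      2 hε] with n hn x y
    have hxy : (x : EuclideanSpace ℝ (Fin (2 * g))) - y ∈ Metric.closedBall 0 2 := by
      have h1 := mem_closedBall_zero_iff.1 x.2
      have h2 := mem_closedBall_zero_iff.1 y.2
      rw [mem_closedBall_zero_iff]
      exact (norm_sub_le _ _).trans (by linarith)
    have := hn _ hxy
    rw [torusNorm, param_sub, ← dist_eq_norm, ← hPF, map_sub, ← FlatTorus.dist_mk] at this
    exact this

theorem ConvergesTo.exists_gHTendsto {A : ℕ → PPAV g} {c : ℕ} (hc : c < g)
    {p : SiegelUpperHalfSpace c} (hA : ConvergesTo A (SatakeBB.mk c hc.le p)) :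
    ∃ φ : ℕ → ℕ, StrictMono φ ∧ ∃ r : ℕ, c ≤ r ∧ r < g ∧
      ∃ (Λ : Submodule ℤ (EuclideanSpace ℝ (Fin (g - r)))) (_ : DiscreteTopology Λ)
        (_ : IsZLattice ℝ Λ),
        Metric.diam (Set.univ : Set (FlatTorus Λ)) = 1 ∧
        GHTendsto (fun n => A (φ n)) (FlatTorus Λ) := by
  have hg : 0 < g := by omega
  obtain ⟨φ, hφ, F, hF, hlim, u, hu, hu0⟩ := hA.exists_subseq hc
  obtain ⟨d, Λ, hΛ, hΛ', P, hP, hPF, hdim⟩ := hF.exists_flatTorus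
  have hd := hdim _ u hu hu0
  rw [finrank_euclideanSpace_fin] at hd
  have hdiam : Metric.diam (Set.univ : Set (FlatTorus Λ)) = 1 := by
    apply le_antisymm
    · refine FlatTorus.diam_le Λ fun z => ?_
      obtain ⟨x, rfl⟩ := hP z
      rw [hPF]
      exact hF.le_one x
    · refine le_of_forall_pos_le_add fun ε hε => ?_
      obtain ⟨n, hn⟩ := (IsTorusNorm.tendstoUniformly_closedBall
        (fun n => (A (φ n)).isTorusNorm hg) hF hlim 1 hε).exists
      obtain ⟨x, hx, hx'⟩ := (A (φ n)).exists_torusNorm_eq_one hg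
      have h1 := (abs_le.1 (hn x (by simp [hx]))).2
      have h2 := FlatTorus.norm_le_diam Λ (FlatTorus.mk Λ (P x))
      rw [hPF] at h2
      linarith
  have hd0 : d ≠ 0 := by
    rintro rfl
    have : Metric.diam (Set.univ : Set (FlatTorus Λ)) ≤ 0 := FlatTorus.diam_le Λ fun x => by
      rw [Subsingleton.elim x 0]
      simp
    linarith
  -- From `d + (g + c) ≤ 2g` one gets `d ≤ g - c`, which is `c ≤ r`; and `d ≠ 0` is `r < g`.
  obtain ⟨r, hr, hrg, rfl⟩ : ∃ r, c ≤ r ∧ r < g ∧ d = g - r :=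
    ⟨g - d, by omega, by omega, by omega⟩
  exact ⟨φ, hφ, r, hr, hrg, Λ, hΛ, hΛ', hdiam,
    gHTendsto_of_tendsto_torusNorm hg hF hlim Λ hP hPF⟩

end PPAV

/-! ### Block sums and scalings of period matrices -/

open Matrix in
/-- A positive definite real matrix is bounded below by a positive multiple of the identity. -/
theorem Matrix.PosDef.exists_pos_mul_le {n : Type*} [Fintype n] {Y : Matrix n n ℝ}
    (hY : Y.PosDef) : ∃ ε > 0, ∀ x : n → ℝ, ε * (x ⬝ᵥ x) ≤ x ⬝ᵥ Y *ᵥ x := by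
  rcases isEmpty_or_nonempty n with hn | hn
  · exact ⟨1, one_pos, fun x => by simp [dotProduct]⟩
  have hS : IsCompact (Metric.sphere (0 : EuclideanSpace ℝ n) 1) := isCompact_sphere _ _
  have hSne : (Metric.sphere (0 : EuclideanSpace ℝ n) 1).Nonempty :=
    NormedSpace.sphere_nonempty.2 zero_le_one
  have hc : Continuous fun x : EuclideanSpace ℝ n => x.ofLp ⬝ᵥ Y *ᵥ x.ofLp := by
    have : Continuous fun x : EuclideanSpace ℝ n => x.ofLp := PiLp.continuous_ofLp 2 _
    exact this.dotProduct (continuous_const.matrix_mulVec this)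
  obtain ⟨x₀, hx₀, hmin⟩ := hS.exists_isMinOn hSne hc.continuousOn
  have hx₀' : x₀.ofLp ≠ 0 := by
    intro h
    have : x₀ = 0 := by ext i; exact congrFun h i
    simp [this] at hx₀
  refine ⟨_, hY.dotProduct_pos hx₀', fun x => ?_⟩
  by_cases hx : x = 0
  · simp [hx]
  set z : EuclideanSpace ℝ n := WithLp.toLp 2 x with hz
  have hz0 : 0 < ‖z‖ := norm_pos_iff.2 fun h => hx (by
    have := congrArg WithLp.ofLp h
    simpa [hz] using this)
  have h1 : ‖z‖ ^ 2 = x ⬝ᵥ x := by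
    rw [EuclideanSpace.real_norm_sq_eq]
    simp [dotProduct, hz, sq]
  have h2 := hmin (a := ‖z‖⁻¹ • z) (by simp [norm_smul, hz0.ne'])
  simp only [Set.mem_ofPred_eq, WithLp.ofLp_smul, mulVec_smul, dotProduct_smul, smul_dotProduct,
    smul_eq_mul] at h2
  have h3 : z.ofLp = x := rfl
  rw [h3, ← mul_assoc, ← sq, inv_pow, h1, inv_mul_eq_div, le_div_iff₀ (h1 ▸ by positivity)] at h2
  exact h2

open Matrix MatrixOrder in
theorem Matrix.PosDef.exists_eq_transpose_mul_self {n : Type*} [Fintype n] [DecidableEq n]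
    {Y : Matrix n n ℝ} (hY : Y.PosDef) : ∃ S : Matrix n n ℝ, Y = Sᵀ * S := by
  obtain ⟨S, hS⟩ := CStarAlgebra.nonneg_iff_eq_star_mul_self.mp hY.posSemidef.nonneg
  refine ⟨S, hS.trans ?_⟩
  rw [star_eq_conjTranspose, conjTranspose_eq_transpose_of_trivial]

namespace SiegelUpperHalfSpace

open Matrix

/-- A positive definite real matrix as a purely imaginary point of the Siegel upper half space. -/
def ofIm {m : ℕ} (Y : Matrix (Fin m) (Fin m) ℝ) (hY : Y.PosDef) : SiegelUpperHalfSpace m :=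
  ⟨Y.map fun y => (y : ℂ) * Complex.I, by
    have h : Y.IsSymm := (conjTranspose_eq_transpose_of_trivial Y).symm.trans hY.isHermitian
    refine ⟨h.map _, ?_⟩
    have e : (Y.map fun y => (y : ℂ) * Complex.I).map Complex.im = Y := by ext i j; simp
    rwa [e]⟩

theorem posDef_fromBlocks {a b : Type*} [Fintype a] [Fintype b] {Y₁ : Matrix a a ℝ}
    {Y₂ : Matrix b b ℝ} (h₁ : Y₁.PosDef) (h₂ : Y₂.PosDef) : (fromBlocks Y₁ 0 0 Y₂).PosDef := by
  refine PosDef.of_dotProduct_mulVec_pos ?_ fun x hx => ?_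
  · exact IsHermitian.fromBlocks h₁.isHermitian (by simp) h₂.isHermitian
  · rw [star_trivial, fromBlocks_mulVec]
    have e : x = Sum.elim (x ∘ Sum.inl) (x ∘ Sum.inr) := (Sum.elim_comp_inl_inr x).symm
    have e2 : x ⬝ᵥ Sum.elim (Y₁ *ᵥ (x ∘ Sum.inl) + 0 *ᵥ (x ∘ Sum.inr))
        (0 *ᵥ (x ∘ Sum.inl) + Y₂ *ᵥ (x ∘ Sum.inr)) =
        (x ∘ Sum.inl) ⬝ᵥ Y₁ *ᵥ (x ∘ Sum.inl) + (x ∘ Sum.inr) ⬝ᵥ Y₂ *ᵥ (x ∘ Sum.inr) := by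
      conv_lhs => rw [e]
      rw [sumElim_dotProduct_sumElim]
      simp
    rw [e2]
    by_cases hl : x ∘ Sum.inl = 0
    · have hr : x ∘ Sum.inr ≠ 0 := fun hr => hx (by rw [e, hl, hr]; ext (i | i) <;> rfl)
      exact add_pos_of_nonneg_of_pos (h₁.dotProduct_nonneg _) (h₂.dotProduct_pos hr)
    · exact add_pos_of_pos_of_nonneg (h₁.dotProduct_pos hl) (h₂.dotProduct_nonneg _)

/-- The block diagonal sum of two points of Siegel upper half spaces. -/
def directSum {a b : ℕ} (Z₁ : SiegelUpperHalfSpace a) (Z₂ : SiegelUpperHalfSpace b) :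
    SiegelUpperHalfSpace (a + b) :=
  ⟨(fromBlocks Z₁.1 0 0 Z₂.1).submatrix finSumFinEquiv.symm finSumFinEquiv.symm, by
    refine ⟨(IsSymm.fromBlocks Z₁.2.1 (by simp) Z₂.2.1).submatrix _, ?_⟩
    have := (posDef_fromBlocks Z₁.2.2 Z₂.2.2).submatrix
      (e := (finSumFinEquiv.symm : Fin (a + b) → _)) finSumFinEquiv.symm.injective
    convert this using 1
    rw [← submatrix_map, fromBlocks_map]
    simp⟩

section directSum

variable {a b : ℕ} (Z₁ : SiegelUpperHalfSpace a) (Z₂ : SiegelUpperHalfSpace b)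

theorem directSum_castAdd_castAdd (i j : Fin a) :
    (directSum Z₁ Z₂).1 (Fin.castAdd b i) (Fin.castAdd b j) = Z₁.1 i j := by
  simp [directSum]

theorem directSum_castAdd_natAdd (i : Fin a) (j : Fin b) :
    (directSum Z₁ Z₂).1 (Fin.castAdd b i) (Fin.natAdd a j) = 0 := by
  simp [directSum]

theorem directSum_natAdd_castAdd (i : Fin b) (j : Fin a) :
    (directSum Z₁ Z₂).1 (Fin.natAdd a i) (Fin.castAdd b j) = 0 := by
  simp [directSum]

theorem directSum_natAdd_natAdd (i j : Fin b) :
    (directSum Z₁ Z₂).1 (Fin.natAdd a i) (Fin.natAdd a j) = Z₂.1 i j := by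
  simp [directSum]

theorem dotProduct_im_directSum (y : Fin (a + b) → ℝ) :
    y ⬝ᵥ (directSum Z₁ Z₂).im *ᵥ y =
      (fun i => y (Fin.castAdd b i)) ⬝ᵥ Z₁.im *ᵥ (fun i => y (Fin.castAdd b i)) +
      (fun i => y (Fin.natAdd a i)) ⬝ᵥ Z₂.im *ᵥ (fun i => y (Fin.natAdd a i)) := by
  simp [dotProduct, mulVec, Fin.sum_univ_add, im, directSum_castAdd_castAdd,
    directSum_castAdd_natAdd, directSum_natAdd_castAdd, directSum_natAdd_natAdd]

end directSum

variable {m : ℕ}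

/-- The point `D Z D` for an invertible real diagonal matrix `D`. -/
def scale (Z : SiegelUpperHalfSpace m) (d : Fin m → ℝ) (hd : ∀ i, d i ≠ 0) :
    SiegelUpperHalfSpace m :=
  ⟨Matrix.of fun i j => (d i : ℂ) * Z.1 i j * d j, by
    refine ⟨?_, ?_⟩
    · ext i j
      simp only [transpose_apply, of_apply]
      rw [Z.2.1.apply i j]
      ring
    · have e : (Matrix.of fun i j => (d i : ℂ) * Z.1 i j * d j).map Complex.im =
          (diagonal d)ᴴ * Z.im * diagonal d := by
        ext i j
        simp [im]
      rw [e]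
      refine Z.im_posDef.conjTranspose_mul_mul_same ?_
      intro x y hxy
      ext i
      have := congrFun hxy i
      simpa [mulVec_diagonal, hd i] using this⟩

theorem dotProduct_im_scale (Z : SiegelUpperHalfSpace m) (d : Fin m → ℝ) (hd : ∀ i, d i ≠ 0)
    (x : Fin m → ℝ) : x ⬝ᵥ (Z.scale d hd).im *ᵥ x = (d * x) ⬝ᵥ Z.im *ᵥ (d * x) := by
  simp only [dotProduct, mulVec, Finset.mul_sum, im, scale, map_apply, of_apply, Pi.mul_apply]
  refine Finset.sum_congr rfl fun i _ => Finset.sum_congr rfl fun j _ => ?_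
  simp
  ring

/-- Rescaling makes a point deep with respect to the coordinates with large factors. -/
theorem isDeep_scale {Z : SiegelUpperHalfSpace m} {ε : ℝ}
    (hε : ∀ x : Fin m → ℝ, ε * (x ⬝ᵥ x) ≤ x ⬝ᵥ Z.im *ᵥ x) {c : ℕ} {T : ℝ}
    {d : Fin m → ℝ} (hd : ∀ i, d i ≠ 0) (h : ∀ i : Fin m, c ≤ (i : ℕ) → T < ε * d i ^ 2)
    (hε0 : 0 < ε) : (Z.scale d hd).IsDeep c T := by
  refine PosDef.of_dotProduct_mulVec_pos ?_ fun x hx => ?_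
  · exact (Z.scale d hd).im_posDef.isHermitian.sub (isHermitian_diagonal _)
  · rw [star_trivial, sub_mulVec, dotProduct_sub]
    change 0 < x ⬝ᵥ (Z.scale d hd).im *ᵥ x - _
    rw [dotProduct_im_scale]
    refine sub_pos.2 (lt_of_lt_of_le ?_ (hε _))
    obtain ⟨j, hj⟩ := Function.ne_iff.1 hx
    have hj2 : 0 < x j * x j := mul_self_pos.2 hj
    simp only [dotProduct, mulVec_diagonal, Finset.mul_sum, Pi.mul_apply]
    have key : ∀ i, x i ≠ 0 → x i * ((if (i : ℕ) < c then (0 : ℝ) else T) * x i) <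
        ε * (d i * x i * (d i * x i)) := by
      intro i hi
      have hi2 : 0 < x i * x i := mul_self_pos.2 hi
      have hdi : 0 < d i ^ 2 := by have := hd i; positivity
      split_ifs with hc
      · have : 0 < ε * d i ^ 2 * (x i * x i) := by positivity
        linarith
      · have := mul_lt_mul_of_pos_right (h i (not_lt.1 hc)) hi2
        linarith
    refine Finset.sum_lt_sum (fun i _ => ?_) ⟨j, Finset.mem_univ _, key j hj⟩
    by_cases hi : x i = 0
    · simp [hi]
    · exact (key i hi).le

theorem upperLeft_scale {c : ℕ} (hc : c ≤ m) (Z : SiegelUpperHalfSpace m) {d : Fin m → ℝ}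
    (hd : ∀ i, d i ≠ 0) (h : ∀ i : Fin m, (i : ℕ) < c → d i = 1) :
    (Z.scale d hd).upperLeft hc = Z.upperLeft hc := by
  refine Subtype.ext (Matrix.ext fun i j => ?_)
  simp [upperLeft, scale, h _ (show ((Fin.castLE hc i : Fin m) : ℕ) < c from i.2),
    h _ (show ((Fin.castLE hc j : Fin m) : ℕ) < c from j.2)]

end SiegelUpperHalfSpace

theorem SatakeBB.tendsto_mk {g c : ℕ} (hc : c ≤ g) {p : SiegelUpperHalfSpace c}
    {Z : ℕ → SiegelUpperHalfSpace g} (h : ∀ n, (Z n).upperLeft hc = p)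
    (h' : ∀ T > 0, ∀ᶠ n in atTop, (Z n).IsDeep c T) :
    Tendsto (fun n => SatakeBB.mk g le_rfl (Z n)) atTop (𝓝 (SatakeBB.mk c hc p)) := by
  rw [tendsto_nhds]
  intro O hO hp
  obtain ⟨W, hW, T, hT, H⟩ := hO c hc p hp
  filter_upwards [h' T hT] with n hn
  exact H g hc le_rfl (Z n) (h n ▸ mem_of_mem_nhds hW) hn

/-! ### Collapse of lattices to a lower dimensional torus -/

/-- The map `P` sends `Λ n` into `s n • Λ'`, and `J` splits it on lattices without increasing norms.
Directions in the kernel of `P` have size at most `C n`, negligible against `s n`, so distances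
differ from `s n` times those of the limit by at most `C n`. -/
theorem tendsto_toGHSpace_of_collapse {V E : Type} [NormedAddCommGroup V] [NormedSpace ℝ V]
    [FiniteDimensional ℝ V] [NormedAddCommGroup E] [NormedSpace ℝ E] [FiniteDimensional ℝ E]
    {Λ : ℕ → Submodule ℤ V} [∀ n, DiscreteTopology (Λ n)] [∀ n, IsZLattice ℝ (Λ n)]
    {Λ' : Submodule ℤ E} [DiscreteTopology Λ'] [IsZLattice ℝ Λ']
    (hdiam : Metric.diam (Set.univ : Set (FlatTorus Λ')) = 1) {P : V →ₗ[ℝ] E} {J : E →ₗ[ℝ] V}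
    (hPJ : ∀ z, P (J z) = z) (hP : ∀ v, ‖P v‖ ≤ ‖v‖) (hJ : ∀ z, ‖J z‖ ≤ ‖z‖) {s C : ℕ → ℝ}
    (hs : ∀ n, 0 < s n) (hPΛ : ∀ n, ∀ l ∈ Λ n, (s n)⁻¹ • P l ∈ Λ')
    (hJΛ : ∀ n, ∀ z ∈ Λ', J (s n • z) ∈ Λ n)
    (hC : ∀ n v, P v = 0 → ‖FlatTorus.mk (Λ n) v‖ ≤ C n)
    (hlim : Tendsto (fun n => C n / s n) atTop (𝓝 0)) :
    Tendsto (fun n => GromovHausdorff.toGHSpace (DiamNormalized (FlatTorus (Λ n)))) atTop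
      (𝓝 (GromovHausdorff.toGHSpace (FlatTorus Λ'))) := by
  have hE : ProperSpace E := FiniteDimensional.proper ℝ E
  have hC0 : ∀ n, 0 ≤ C n := fun n => (norm_nonneg _).trans (hC n 0 (map_zero P))
  have lower : ∀ n v, s n * ‖FlatTorus.mk Λ' (P v)‖ ≤ ‖FlatTorus.mk (Λ n) (s n • v)‖ := by
    intro n v
    rw [FlatTorus.le_norm_mk_iff]
    intro l hl
    have h1 := FlatTorus.norm_mk_le_of_mem Λ' (x := P v) (hPΛ n l hl)
    have h2 : P (s n • v - l) = s n • (P v - (s n)⁻¹ • P l) := by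
      rw [smul_sub, smul_inv_smul₀ (hs n).ne', map_sub, map_smul]
    calc s n * ‖FlatTorus.mk Λ' (P v)‖ ≤ s n * ‖P v - (s n)⁻¹ • P l‖ :=
          mul_le_mul_of_nonneg_left h1 (hs n).le
      _ = ‖P (s n • v - l)‖ := by rw [h2, norm_smul, Real.norm_of_nonneg (hs n).le]
      _ ≤ _ := hP _
  have upper : ∀ n v, ‖FlatTorus.mk (Λ n) (s n • v)‖ ≤ s n * ‖FlatTorus.mk Λ' (P v)‖ + C n := by
    intro n v
    obtain ⟨z, hz, hz'⟩ := FlatTorus.exists_norm_mk_eq Λ' (P v)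
    -- The first summand is moved by a lattice vector from the image of `J`; the second lies in the
    -- kernel of `P`.
    have e : s n • v = J (s n • P v) + s n • (v - J (P v)) := by
      rw [map_smul, smul_sub]; abel
    rw [e, FlatTorus.mk_add, hz']
    refine (norm_add_le _ _).trans (add_le_add ?_ (hC n _ ?_))
    · refine (FlatTorus.norm_mk_le_of_mem (Λ n) (hJΛ n z hz)).trans ?_
      rw [← map_sub, ← smul_sub]
      refine (hJ _).trans ?_
      rw [norm_smul, Real.norm_of_nonneg (hs n).le]
    · rw [map_smul, map_sub, hPJ, sub_self, smul_zero]
  have hq : ∀ v, ‖FlatTorus.mk Λ' (P v)‖ ≤ 1 := fun v => hdiam ▸ FlatTorus.norm_le_diam Λ' _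
  have hsurj : ∀ n, Function.Surjective fun v => FlatTorus.mk (Λ n) (s n • v) := by
    intro n z
    obtain ⟨v, rfl⟩ := FlatTorus.mk_surjective (Λ n) z
    exact ⟨(s n)⁻¹ • v, by simp only [smul_inv_smul₀ (hs n).ne']⟩
  have hD1 : ∀ n, s n ≤ Metric.diam (Set.univ : Set (FlatTorus (Λ n))) := by
    intro n
    obtain ⟨z, hz⟩ := FlatTorus.exists_norm_eq_diam Λ'
    have := (lower n (J z)).trans (FlatTorus.norm_le_diam (Λ n) _)
    rwa [hPJ, hz, hdiam, mul_one] at this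
  have hD2 : ∀ n, Metric.diam (Set.univ : Set (FlatTorus (Λ n))) ≤ s n + C n := by
    intro n
    refine FlatTorus.diam_le (Λ n) fun v => ?_
    obtain ⟨w, hw⟩ := hsurj n (FlatTorus.mk (Λ n) v)
    rw [← hw]
    have := mul_le_mul_of_nonneg_left (hq w) (hs n).le
    linarith [upper n w]
  refine tendsto_toGHSpace_of_surjective (K := V) (p := fun n v => FlatTorus.mk (Λ n) (s n • v))
    (q := fun v => FlatTorus.mk Λ' (P v)) hsurj ?_ ?_
  · intro z
    obtain ⟨z, rfl⟩ := FlatTorus.mk_surjective Λ' z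
    exact ⟨J z, by simp only [hPJ]⟩
  · intro ε hε
    filter_upwards [hlim.eventually_lt_const hε] with n hn x y
    rw [DiamNormalized.dist_eq, FlatTorus.dist_mk, FlatTorus.dist_mk, ← smul_sub, ← map_sub]
    have h1 := lower n (x - y)
    have h2 := upper n (x - y)
    have h3 := hq (x - y)
    have h4 := norm_nonneg (FlatTorus.mk Λ' (P (x - y)))
    have hsn := hs n
    have hCn := hC0 n
    have hDn1 := hD1 n
    have hDn2 := hD2 n
    rw [div_lt_iff₀ hsn] at hn
    set D := Metric.diam (Set.univ : Set (FlatTorus (Λ n)))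
    set t := ‖FlatTorus.mk Λ' (P (x - y))‖
    set N := ‖FlatTorus.mk (Λ n) (s n • (x - y))‖
    have hD : 0 < D := hsn.trans_le hDn1
    -- Here `N` lies between `s t` and `s t + C`, `D` between `s` and `s + C`, and `t ≤ 1`. So the
    -- difference is at most `C < ε s ≤ ε D`.
    have h5 : |N - t * D| ≤ ε * D := by
      have h6 : ε * s n ≤ ε * D := mul_le_mul_of_nonneg_left hDn1 hε.le
      have h7 : t * s n ≤ t * D := mul_le_mul_of_nonneg_left hDn1 h4
      have h8 : t * D ≤ t * (s n + C n) := mul_le_mul_of_nonneg_left hDn2 h4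
      have h9 : t * C n ≤ 1 * C n := mul_le_mul_of_nonneg_right h3 hCn
      rw [abs_le]
      constructor <;> nlinarith
    have h6 : N / D - t = (N - t * D) / D := by field_simp
    rw [h6, abs_div, abs_of_pos hD, div_le_iff₀ hD]
    exact h5

namespace SiegelUpperHalfSpace

open Matrix

theorem form_pos {m : ℕ} (Z : SiegelUpperHalfSpace m) {u : Fin m ⊕ Fin m → ℝ} (hu : u ≠ 0) :
    0 < Z.form u := by
  by_cases hy : u ∘ Sum.inl = 0
  · refine add_pos_of_pos_of_nonneg (Z.im_posDef.inv.dotProduct_pos fun hw => hu ?_)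
      (Z.im_posDef.dotProduct_nonneg _)
    rw [rePoint, hy, mulVec_zero, add_zero] at hw
    ext (i | i)
    exacts [congrFun hy i, congrFun hw i]
  · exact add_pos_of_nonneg_of_pos (Z.im_posDef.inv.dotProduct_nonneg _)
      (Z.im_posDef.dotProduct_pos hy)

theorem dotProduct_im_le_form {m : ℕ} (Z : SiegelUpperHalfSpace m) (u : Fin m ⊕ Fin m → ℝ) :
    (u ∘ Sum.inl) ⬝ᵥ Z.im *ᵥ (u ∘ Sum.inl) ≤ Z.form u :=
  le_add_of_nonneg_left (Z.im_posDef.inv.dotProduct_nonneg _)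

end SiegelUpperHalfSpace

/-! ### Abelian varieties spanned by period frames -/

namespace IsPeriodFrame

open Matrix

variable {g : ℕ} {V : Type*} [NormedAddCommGroup V] [InnerProductSpace ℂ V]
  {Z : SiegelUpperHalfSpace g} {a b : Fin g → V}

theorem linearIndependent (h : IsPeriodFrame Z a b) : LinearIndependent ℝ (Sum.elim b a) := by
  rw [Fintype.linearIndependent_iff]
  intro u hu
  have h0 : Z.form u = 0 := by rw [← h.norm_sq_sum_eq_form, hu]; simp
  by_contra! hne
  obtain ⟨i, hi⟩ := hne
  exact (Z.form_pos (u := u) fun h => hi (congrFun h i)).ne' h0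

theorem linearIndependent' (h : IsPeriodFrame Z a b) : LinearIndependent ℝ (Sum.elim a b) := by
  have := h.linearIndependent.comp Sum.swap Sum.swap_leftInverse.injective
  have e : Sum.elim a b = Sum.elim b a ∘ Sum.swap := by ext (i | i) <;> rfl
  rw [e]
  exact this

theorem inner_left_right (h : IsPeriodFrame Z a b) (k i : Fin g) :
    inner ℂ (a k) (b i) = ∑ l, Z.1 l i * ((Z.im⁻¹ k l : ℝ) : ℂ) := by
  rw [h.eq_sum, inner_sum]
  exact Finset.sum_congr rfl fun l _ => by rw [inner_smul_right, h.inner_left]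

/-- Expanding `b_j` leaves `X_ji - X_ij` with `X = Re Z`, which vanishes because `Z` is symmetric.
-/
theorem im_inner_right (h : IsPeriodFrame Z a b) (i j : Fin g) :
    (inner ℂ (b i) (b j) : ℂ).im = 0 := by
  have hre : ∀ k, (inner ℂ (a k) (b i) : ℂ).re = (Z.im⁻¹ * Z.re) k i := by
    intro k
    rw [h.inner_left_right, Complex.re_sum, Matrix.mul_apply]
    refine Finset.sum_congr rfl fun l _ => ?_
    rw [Complex.re_mul_ofReal, mul_comm]
    rfl
  have h1 : ∀ k, (Z.1 k j * inner ℂ (b i) (a k)).im =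
      Z.im j k * (Z.im⁻¹ * Z.re) k i - if k = i then Z.re k j else 0 := by
    intro k
    rw [← inner_conj_symm (b i) (a k), Complex.mul_im, Complex.conj_re, Complex.conj_im, h.im_inner,
      hre, ← Z.im_isSymm.apply j k]
    simp only [SiegelUpperHalfSpace.re, SiegelUpperHalfSpace.im, map_apply]
    split_ifs <;> ring
  rw [h.eq_sum j, inner_sum, Complex.im_sum]
  simp only [inner_smul_right, h1, Finset.sum_sub_distrib]
  rw [← Matrix.mul_apply, ← Matrix.mul_assoc, mul_nonsing_inv _ Z.isUnit_det_im, Matrix.one_mul]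
  simp [Z.re_isSymm.apply i j]

theorem im_inner_right_left (h : IsPeriodFrame Z a b) (i j : Fin g) :
    (inner ℂ (b i) (a j) : ℂ).im = if i = j then -1 else 0 := by
  rw [← inner_conj_symm, Complex.conj_im, h.im_inner]
  simp only [eq_comm (a := i)]
  split_ifs <;> simp

/-- Inverse factors on `a` and `b` preserve the symplectic relations. All members of the
degenerating family thus live in one fixed Hermitian space, and only the lattice varies. -/
theorem scale (h : IsPeriodFrame Z a b) (d : Fin g → ℝ) (hd : ∀ i, d i ≠ 0) :
    IsPeriodFrame (Z.scale d hd) (fun i => (d i)⁻¹ • a i) (fun i => d i • b i) := by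
  simp only [← Complex.coe_smul]
  refine ⟨fun i j => ?_, fun i j => ?_, fun j => ?_⟩
  · rw [inner_smul_left, inner_smul_right, Complex.conj_ofReal, Complex.im_ofReal_mul,
      Complex.im_ofReal_mul, h.im_inner_left, mul_zero, mul_zero]
  · rw [inner_smul_left, inner_smul_right, Complex.conj_ofReal, Complex.im_ofReal_mul,
      Complex.im_ofReal_mul, h.im_inner]
    split_ifs with hij
    · rw [hij, mul_one, inv_mul_cancel₀ (hd j)]
    · rw [mul_zero, mul_zero]
  · rw [h.eq_sum, Finset.smul_sum]
    refine Finset.sum_congr rfl fun i _ => ?_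
    have : (d i : ℂ) ≠ 0 := by exact_mod_cast hd i
    have e : (Z.scale d hd).1 i j = d i * Z.1 i j * d j := rfl
    rw [smul_smul, smul_smul, e]
    congr 1
    push_cast
    field_simp

/-- The Gram matrix of `a` has to be `Y⁻¹ = SᵀS`, so the columns of `S` serve as `a`. -/
theorem exists_of_siegel (Z : SiegelUpperHalfSpace g) :
    ∃ a b : Fin g → EuclideanSpace ℂ (Fin g), IsPeriodFrame Z a b := by
  obtain ⟨S, hS⟩ := Z.im_posDef.inv.exists_eq_transpose_mul_self
  let a : Fin g → EuclideanSpace ℂ (Fin g) := fun i => WithLp.toLp 2 fun k => ((S k i : ℝ) : ℂ)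
  have ha : ∀ i j, inner ℂ (a i) (a j) = ((Z.im⁻¹ i j : ℝ) : ℂ) := by
    intro i j
    rw [hS, Matrix.mul_apply]
    simp [a, PiLp.inner_apply, mul_comm]
  refine ⟨a, fun j => ∑ i, Z.1 i j • a i, ?_, ?_, fun j => rfl⟩
  · intro i j
    rw [ha, Complex.ofReal_im]
  · intro i j
    rw [inner_sum, Complex.im_sum, ← Matrix.one_apply, ← nonsing_inv_mul _ Z.isUnit_det_im,
      Matrix.mul_apply]
    refine Finset.sum_congr rfl fun k _ => ?_
    rw [inner_smul_right, ha, Complex.im_mul_ofReal, mul_comm]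
    rfl

end IsPeriodFrame

section ofFrame

variable {g : ℕ} {V : Type} [NormedAddCommGroup V] [InnerProductSpace ℂ V]
  [FiniteDimensional ℂ V] {Z : SiegelUpperHalfSpace g} {a b : Fin g → V}

/-- The real basis formed by a period frame. -/
noncomputable def IsPeriodFrame.basis (h : IsPeriodFrame Z a b) (hV : Module.finrank ℂ V = g) :
    Module.Basis (Fin g ⊕ Fin g) ℝ V :=
  have : FiniteDimensional ℝ V := FiniteDimensional.complexToReal V
  basisOfLinearIndependentOfCardEqFinrank' (Sum.elim a b) h.linearIndependent'
    (by rw [finrank_real_of_complex, hV, Fintype.card_sum, Fintype.card_fin, two_mul])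

theorem IsPeriodFrame.coe_basis (h : IsPeriodFrame Z a b) (hV : Module.finrank ℂ V = g) :
    ⇑(h.basis hV) = Sum.elim a b := by
  simp [basis]

/-- The principally polarized abelian variety whose period lattice is spanned by a period frame. -/
noncomputable def PPAV.ofFrame (h : IsPeriodFrame Z a b) (hV : Module.finrank ℂ V = g) : PPAV g where
  V := V
  finrank_eq := hV
  Λ := Submodule.span ℤ (Set.range (h.basis hV))
  integral x hx y hy := by
    have key : ∀ i j : Fin g ⊕ Fin g,
        ∃ n : ℤ, (inner ℂ (h.basis hV i) (h.basis hV j) : ℂ).im = n := by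
      rw [h.coe_basis]
      rintro (i | i) (j | j)
      · exact ⟨0, by simpa using h.im_inner_left i j⟩
      · exact ⟨if i = j then 1 else 0, by simpa using h.im_inner i j⟩
      · exact ⟨if i = j then -1 else 0, by simpa using h.im_inner_right_left i j⟩
      · exact ⟨0, by simpa using h.im_inner_right i j⟩
    induction hx using Submodule.span_induction with
    | mem x hx =>
      obtain ⟨i, rfl⟩ := hx
      induction hy using Submodule.span_induction with
      | mem y hy => obtain ⟨j, rfl⟩ := hy; exact key i j
      | zero => exact ⟨0, by simp⟩
      | add y z _ _ h1 h2 =>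
        obtain ⟨m, hm⟩ := h1
        obtain ⟨n, hn⟩ := h2
        exact ⟨m + n, by rw [inner_add_right, Complex.add_im, hm, hn, Int.cast_add]⟩
      | smul k y _ h1 =>
        obtain ⟨m, hm⟩ := h1
        refine ⟨k * m, ?_⟩
        rw [← Int.cast_smul_eq_zsmul ℂ, inner_smul_right, Complex.mul_im, hm]
        simp
    | zero => exact ⟨0, by simp⟩
    | add x z _ _ h1 h2 =>
      obtain ⟨m, hm⟩ := h1
      obtain ⟨n, hn⟩ := h2
      exact ⟨m + n, by rw [inner_add_left, Complex.add_im, hm, hn, Int.cast_add]⟩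
    | smul k x _ h1 =>
      obtain ⟨m, hm⟩ := h1
      refine ⟨k * m, ?_⟩
      rw [← Int.cast_smul_eq_zsmul ℂ, inner_smul_left, Complex.mul_im, hm]
      simp
  unimodular f := by
    let B := (h.basis hV).restrictScalars ℤ
    have hB : ∀ i, (B i : V) = Sum.elim a b i := fun i => by
      rw [Module.Basis.restrictScalars_apply, h.coe_basis]
    -- The vector dual to `f` for a symplectic basis: pairing with `b_j` reads off the first term
    -- and pairing with `a_j` the second, the sign coming from `Im H(b_j, a_j) = -1`.
    let x := ∑ i, (f (B (.inr i)) • B (.inl i) - f (B (.inl i)) • B (.inr i))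
    refine ⟨x, x.2, fun y => ?_⟩
    let F : Submodule.span ℤ (Set.range (h.basis hV)) →ₗ[ℤ] ℝ :=
      { toFun := fun y => (inner ℂ (x : V) (y : V) : ℂ).im
        map_add' := fun y z => by
          rw [Submodule.coe_add, inner_add_right, Complex.add_im]
        map_smul' := fun k y => by
          rw [Submodule.coe_smul, ← Int.cast_smul_eq_zsmul ℂ, inner_smul_right, Complex.mul_im]
          simp }
    have hF : F = (Int.castAddHom ℝ).toIntLinearMap ∘ₗ f := by
      refine B.ext fun j => ?_
      have hx : (x : V) = ∑ i, (((f (B (.inr i)) : ℤ) : ℂ) • a i -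
          ((f (B (.inl i)) : ℤ) : ℂ) • b i) := by
        simp [x, hB, Int.cast_smul_eq_zsmul]
      change (inner ℂ (x : V) (B j : V) : ℂ).im = ((f (B j) : ℤ) : ℝ)
      rw [hx, hB, sum_inner, Complex.im_sum]
      simp only [inner_sub_left, inner_smul_left, Complex.sub_im, Complex.mul_im, map_intCast,
        Complex.intCast_re, Complex.intCast_im, zero_mul, add_zero]
      rcases j with j | j
      · simp [h.im_inner_left, h.im_inner_right_left]
      · simp [h.im_inner, h.im_inner_right]
    exact LinearMap.congr_fun hF y

theorem PPAV.ofFrame_hasPeriodMatrix (h : IsPeriodFrame Z a b) (hV : Module.finrank ℂ V = g) :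
    (PPAV.ofFrame h hV).HasPeriodMatrix Z := by
  let B := (h.basis hV).restrictScalars ℤ
  have hB : ∀ i, (B i : V) = Sum.elim a b i := fun i => by
    rw [Module.Basis.restrictScalars_apply, h.coe_basis]
  refine ⟨B, fun i j => ?_, fun i j => ?_, fun i j => ?_, fun j => ?_⟩
  · exact (congrArg₂ (fun x y : V => (inner ℂ x y : ℂ).im) (hB (.inl i)) (hB (.inl j))).trans
      (h.im_inner_left i j)
  · exact (congrArg₂ (fun x y : V => (inner ℂ x y : ℂ).im) (hB (.inr i)) (hB (.inr j))).trans
      (h.im_inner_right i j)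
  · exact (congrArg₂ (fun x y : V => (inner ℂ x y : ℂ).im) (hB (.inl i)) (hB (.inr j))).trans
      (h.im_inner i j)
  · refine (hB (.inr j)).trans ((h.eq_sum j).trans ?_)
    exact Finset.sum_congr rfl fun i _ => congrArg (fun x : V => Z.1 i j • x) (hB (.inl i)).symm

end ofFrame

/-! ### The degenerating family with prescribed limit -/

namespace SiegelUpperHalfSpace

open Matrix

variable {c k l : ℕ} {E : Type*} [NormedAddCommGroup E] [InnerProductSpace ℝ E]

theorem posDef_gram_basis (w : Module.Basis (Fin l) ℝ E) : (gram ℝ w).PosDef :=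
  posDef_gram_iff_linearIndependent.2 w.linearIndependent

/-- The block diagonal point with blocks `p`, `i` times the identity and `i` times the Gram matrix of
a basis. -/
noncomputable def withGram (k : ℕ) (p : SiegelUpperHalfSpace c) (w : Module.Basis (Fin l) ℝ E) :
    SiegelUpperHalfSpace (c + k + l) :=
  directSum (directSum p (ofIm (1 : Matrix (Fin k) (Fin k) ℝ) PosDef.one))
    (ofIm (gram ℝ w) (posDef_gram_basis w))

variable (p : SiegelUpperHalfSpace c) (w : Module.Basis (Fin l) ℝ E)

theorem upperLeft_withGram :
    (withGram k p w).upperLeft ((Nat.le_add_right c k).trans (Nat.le_add_right (c + k) l)) = p := by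
  refine Subtype.ext (Matrix.ext fun i j => ?_)
  refine Eq.trans ?_ (directSum_castAdd_castAdd p
    (ofIm (1 : Matrix (Fin k) (Fin k) ℝ) PosDef.one) i j)
  exact directSum_castAdd_castAdd _ _ (Fin.castAdd k i) (Fin.castAdd k j)

theorem im_ofIm {m : ℕ} (Y : Matrix (Fin m) (Fin m) ℝ) (hY : Y.PosDef) : (ofIm Y hY).im = Y := by
  ext i j; simp [ofIm, im]

theorem re_ofIm {m : ℕ} (Y : Matrix (Fin m) (Fin m) ℝ) (hY : Y.PosDef) (i j : Fin m) :
    ((ofIm Y hY).1 i j).re = 0 := by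
  simp [ofIm]

/-- This makes the projection onto the last `b`-coordinates norm nonincreasing. -/
theorem norm_sq_sum_le_form_withGram (u : Fin (c + k + l) ⊕ Fin (c + k + l) → ℝ) :
    ‖∑ j, u (Sum.inl (Fin.natAdd (c + k) j)) • w j‖ ^ 2 ≤ (withGram k p w).form u := by
  refine le_trans ?_ (dotProduct_im_le_form _ u)
  rw [withGram, dotProduct_im_directSum, im_ofIm, ← real_inner_self_eq_norm_sq,
    ← star_dotProduct_gram_mulVec, star_trivial]
  exact le_add_of_nonneg_left (Matrix.PosDef.dotProduct_nonneg (im_posDef _) _)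

/-- The last block is purely imaginary, so real combinations of its vectors `b_j` have no real part
to contribute. They form an isometric copy of `E`. -/
theorem form_withGram (t : Fin l → ℝ) :
    (withGram k p w).form (Sum.elim (Fin.append 0 t) 0) = ‖∑ j, t j • w j‖ ^ 2 := by
  have h1 : (withGram k p w).rePoint (Sum.elim (Fin.append 0 t) 0) = 0 := by
    ext i
    refine Fin.addCases (fun i => ?_) (fun i => ?_) i
    · simp [rePoint, mulVec, dotProduct, Fin.sum_univ_add (b := l), re, withGram,
        directSum_castAdd_natAdd]
    · simp [rePoint, mulVec, dotProduct, Fin.sum_univ_add (b := l), re, withGram,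
        directSum_natAdd_natAdd, re_ofIm]
  rw [form, h1, Sum.elim_comp_inl, withGram, dotProduct_im_directSum, im_ofIm,
    ← real_inner_self_eq_norm_sq, ← star_dotProduct_gram_mulVec, star_trivial]
  simp

end SiegelUpperHalfSpace

/-- The scaling factors `1, N, N ^ 2` on three blocks. -/
def blockScale (c k l : ℕ) (N : ℝ) (i : Fin (c + k + l)) : ℝ :=
  if (i : ℕ) < c then 1 else if (i : ℕ) < c + k then N else N ^ 2

theorem blockScale_natAdd (c k l : ℕ) (N : ℝ) (j : Fin l) :
    blockScale c k l N (Fin.natAdd (c + k) j) = N ^ 2 := by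
  rw [blockScale, if_neg, if_neg] <;> simp only [Fin.val_natAdd] <;> omega

theorem one_le_blockScale {c k l : ℕ} {N : ℝ} (hN : 1 ≤ N) (i : Fin (c + k + l)) :
    1 ≤ blockScale c k l N i := by
  rw [blockScale]
  split_ifs
  exacts [le_rfl, hN, one_le_pow₀ hN]

theorem blockScale_castAdd_le {c k l : ℕ} {N : ℝ} (hN : 1 ≤ N) (i : Fin (c + k)) :
    blockScale c k l N (Fin.castAdd l i) ≤ N := by
  rw [blockScale]
  split_ifs with h1 h2
  exacts [hN, le_rfl, absurd i.2 h2]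

theorem le_blockScale {c k l : ℕ} {N : ℝ} (hN : 1 ≤ N) {i : Fin (c + k + l)} (hi : c ≤ (i : ℕ)) :
    N ≤ blockScale c k l N i := by
  rw [blockScale, if_neg (not_lt.2 hi)]
  split_ifs
  exacts [le_rfl, le_self_pow₀ hN two_ne_zero]

namespace PPAV

variable {c k l : ℕ} {E : Type} [NormedAddCommGroup E] [InnerProductSpace ℝ E]
  [FiniteDimensional ℝ E]

/-- Both scaled blocks go to infinity, which gives convergence to `p`; but the middle one is of
lower order than the last, so only the last is visible after normalization. -/
theorem exists_convergesTo_gHTendsto (k : ℕ) (p : SiegelUpperHalfSpace c)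
    (w : Module.Basis (Fin l) ℝ E)
    {Λ : Submodule ℤ E} [DiscreteTopology Λ] [IsZLattice ℝ Λ]
    (hw : Submodule.span ℤ (Set.range w) = Λ)
    (hdiam : Metric.diam (Set.univ : Set (FlatTorus Λ)) = 1) :
    ∃ A : ℕ → PPAV (c + k + l), ConvergesTo A (SatakeBB.mk c
      ((Nat.le_add_right c k).trans (Nat.le_add_right (c + k) l)) p) ∧
      GHTendsto A (FlatTorus Λ) := by
  set Z := SiegelUpperHalfSpace.withGram k p w with hZ
  obtain ⟨a, b, h⟩ := IsPeriodFrame.exists_of_siegel Z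
  have hV : Module.finrank ℂ (EuclideanSpace ℂ (Fin (c + k + l))) = c + k + l :=
    finrank_euclideanSpace_fin
  let N : ℕ → ℝ := fun n => n + 1
  have hN : ∀ n, 1 ≤ N n := fun n => le_add_of_nonneg_left n.cast_nonneg
  have hN0 : ∀ n, 0 < N n := fun n => one_pos.trans_le (hN n)
  have hNlim : Tendsto N atTop atTop :=
    tendsto_atTop_add_const_right _ _ tendsto_natCast_atTop_atTop
  let d : ℕ → Fin (c + k + l) → ℝ := fun n => blockScale c k l (N n)
  have hd1 : ∀ n i, 1 ≤ d n i := fun n i => one_le_blockScale (hN n) i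
  have hd0 : ∀ n i, 0 < d n i := fun n i => one_pos.trans_le (hd1 n i)
  have hd : ∀ n i, d n i ≠ 0 := fun n i => (hd0 n i).ne'
  have hn := fun n => h.scale (d n) (hd n)
  refine ⟨fun n => ofFrame (hn n) hV, ⟨fun n => Z.scale (d n) (hd n),
    fun n => ofFrame_hasPeriodMatrix _ hV, SatakeBB.tendsto_mk _ (fun n => ?_) fun T hT => ?_⟩, ?_⟩
  · rw [SiegelUpperHalfSpace.upperLeft_scale, SiegelUpperHalfSpace.upperLeft_withGram]
    exact fun i hi => if_pos hi
  · obtain ⟨ε, hε, hεZ⟩ := Z.im_posDef.exists_pos_mul_le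
    filter_upwards [hNlim.eventually_gt_atTop (T / ε)] with n hn
    refine SiegelUpperHalfSpace.isDeep_scale hεZ (hd n) (fun i hi => ?_) hε
    rw [div_lt_iff₀ hε] at hn
    have h1 : N n ≤ d n i := le_blockScale (hN n) hi
    have h2 : d n i ≤ d n i ^ 2 := le_self_pow₀ (hd1 n i) two_ne_zero
    nlinarith
  · have hfin : FiniteDimensional ℝ (EuclideanSpace ℂ (Fin (c + k + l))) :=
      FiniteDimensional.complexToReal _
    let B := h.basis hV
    have hBl : ∀ i, B (.inl i) = a i := fun i => congrFun (h.coe_basis hV) _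
    have hBr : ∀ i, B (.inr i) = b i := fun i => congrFun (h.coe_basis hV) _
    let P : EuclideanSpace ℂ (Fin (c + k + l)) →ₗ[ℝ] E :=
      ∑ j, (B.coord (.inr (Fin.natAdd (c + k) j))).smulRight (w j)
    let J : E →ₗ[ℝ] EuclideanSpace ℂ (Fin (c + k + l)) :=
      w.constr ℝ fun j => b (Fin.natAdd (c + k) j)
    have hP : ∀ v, P v = ∑ j, B.repr v (.inr (Fin.natAdd (c + k) j)) • w j := fun v => by
      simp [P]
    have hJw : ∀ j, J (w j) = b (Fin.natAdd (c + k) j) := fun j => w.constr_basis ℝ _ j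
    have hPa : ∀ i, P (a i) = 0 := fun i => by
      rw [hP, ← hBl]; simp
    have hPb1 : ∀ i, P (b (Fin.castAdd l i)) = 0 := fun i => by
      rw [hP, ← hBr]
      refine Finset.sum_eq_zero fun j _ => ?_
      have : Fin.castAdd l i ≠ Fin.natAdd (c + k) j := by
        simp only [ne_eq, Fin.ext_iff, Fin.val_castAdd, Fin.val_natAdd]; omega
      simp [this]
    have hPb2 : ∀ j, P (b (Fin.natAdd (c + k) j)) = w j := fun j => by
      rw [hP, ← hBr]
      simp [Finsupp.single_apply]
    have hPJ : ∀ z, P (J z) = z := by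
      intro z
      have : P ∘ₗ J = LinearMap.id := w.ext fun j => by simp [hJw, hPb2]
      exact LinearMap.congr_fun this z
    have hsum : ∀ v, ∑ i, B.repr v (Sum.swap i) • Sum.elim b a i = v := by
      intro v
      have h1 := B.sum_repr v
      simp only [Fintype.sum_sum_type, hBl, hBr] at h1
      rw [Fintype.sum_sum_type]
      exact (add_comm _ _).trans h1
    have hPn : ∀ v, ‖P v‖ ≤ ‖v‖ := by
      intro v
      have h1 := h.norm_sq_sum_eq_form (fun i => B.repr v (Sum.swap i))
      have h2 := SiegelUpperHalfSpace.norm_sq_sum_le_form_withGram (k := k) p w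
        (fun i => B.repr v (Sum.swap i))
      rw [← hZ, ← h1, hsum] at h2
      rw [hP]
      exact le_of_sq_le_sq h2 (norm_nonneg _)
    have hJn : ∀ z, ‖J z‖ ≤ ‖z‖ := by
      intro z
      have h1 := h.norm_sq_sum_eq_form (Sum.elim (Fin.append 0 (w.repr z)) 0)
      rw [hZ, SiegelUpperHalfSpace.form_withGram, w.sum_repr] at h1
      have h2 : ∑ i, Sum.elim (Fin.append (0 : Fin (c + k) → ℝ) (w.repr z)) 0 i • Sum.elim b a i =
          J z := by
        have h3 : J z = ∑ j, w.repr z j • b (Fin.natAdd (c + k) j) := by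
          conv_lhs => rw [← w.sum_repr z, map_sum]
          simp only [map_smul, hJw]
        rw [h3]
        simp [Fintype.sum_sum_type, Fin.sum_univ_add (b := l)]
      rw [h2] at h1
      exact le_of_sq_le_sq h1.le (norm_nonneg _)
    have hcoe : ∀ n, ⇑((hn n).basis hV) =
        Sum.elim (fun i => (d n i)⁻¹ • a i) fun i => d n i • b i := fun n => (hn n).coe_basis hV
    have hdl : ∀ n j, d n (Fin.natAdd (c + k) j) = N n ^ 2 := fun n j =>
      blockScale_natAdd c k l (N n) j
    -- The limit lattice is scaled by `N²`, whereas the kernel of `P` is spanned by lattice vectors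
    -- of length at most `N` times that of the corresponding unscaled vector.
    refine tendsto_toGHSpace_of_collapse (P := P) (J := J)
      (Λ := fun n => Submodule.span ℤ (Set.range ((hn n).basis hV))) (s := fun n => N n ^ 2)
      (C := fun n => N n * (∑ i, ‖a i‖ + ∑ i, ‖b i‖)) hdiam hPJ hPn hJn
      (fun n => pow_pos (hN0 n) 2) ?_ ?_ ?_ ?_
    · intro n v hv
      induction hv using Submodule.span_induction with
      | mem v hv =>
        obtain ⟨i, rfl⟩ := hv
        rw [hcoe]
        rcases i with i | i
        · simp [hPa]
        · refine Fin.addCases (fun i => ?_) (fun i => ?_) i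
          · simp [hPb1]
          · rw [Sum.elim_inr, map_smul, hPb2, hdl, inv_smul_smul₀ (pow_pos (hN0 n) 2).ne', ← hw]
            exact Submodule.subset_span ⟨i, rfl⟩
      | zero => simp
      | add x y _ _ hx hy => rw [map_add, smul_add]; exact Λ.add_mem hx hy
      | smul m x _ hx => rw [map_zsmul, smul_comm]; exact Λ.smul_mem m hx
    · intro n z hz
      rw [← hw] at hz
      induction hz using Submodule.span_induction with
      | mem z hz =>
        obtain ⟨j, rfl⟩ := hz
        refine Submodule.subset_span ⟨.inr (Fin.natAdd (c + k) j), ?_⟩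
        rw [hcoe, Sum.elim_inr, map_smul, hJw, hdl]
      | zero => simp
      | add x y _ _ hx hy => rw [smul_add, map_add]; exact Submodule.add_mem _ hx hy
      | smul m x _ hx => rw [smul_comm, map_zsmul]; exact Submodule.smul_mem _ m hx
    · intro n v hv
      have hy : ∀ j, B.repr v (.inr (Fin.natAdd (c + k) j)) = 0 := by
        rw [hP] at hv
        exact Fintype.linearIndependent_iff.1 w.linearIndependent _ hv
      -- These are the lattice vectors spanning the kernel of `P`: all the scaled `a` and the scaled
      -- `b` of the first two blocks.
      let f : Fin (c + k + l) ⊕ Fin (c + k) → EuclideanSpace ℂ (Fin (c + k + l)) :=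
        Sum.elim (fun i => (d n i)⁻¹ • a i) fun i => d n (Fin.castAdd l i) • b (Fin.castAdd l i)
      have hf : ∀ i, f i ∈ Submodule.span ℤ (Set.range ((hn n).basis hV)) := by
        rintro (i | i)
        · exact Submodule.subset_span ⟨.inl i, by rw [hcoe]; rfl⟩
        · exact Submodule.subset_span ⟨.inr (Fin.castAdd l i), by rw [hcoe]; rfl⟩
      have hv' : v = ∑ i, (Sum.elim (fun i => d n i * B.repr v (.inl i)) fun i =>
          (d n (Fin.castAdd l i))⁻¹ * B.repr v (.inr (Fin.castAdd l i)) :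
            Fin (c + k + l) ⊕ Fin (c + k) → ℝ) i • f i := by
        conv_lhs => rw [← B.sum_repr v]
        rw [Fintype.sum_sum_type, Fintype.sum_sum_type]
        congr 1
        · refine Finset.sum_congr rfl fun i _ => ?_
          simp only [f, Sum.elim_inl]
          rw [smul_smul, hBl, mul_right_comm, mul_inv_cancel₀ (hd n i), one_mul]
        · rw [Fin.sum_univ_add (b := l)]
          simp only [hy, zero_smul, Finset.sum_const_zero, add_zero]
          refine Finset.sum_congr rfl fun i _ => ?_
          simp only [f, Sum.elim_inr]
          rw [smul_smul, hBr, mul_right_comm, inv_mul_cancel₀ (hd n _), one_mul]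
      rw [hv']
      refine (FlatTorus.norm_mk_sum_smul_le _ hf _).trans ?_
      rw [Fintype.sum_sum_type, mul_add, Fin.sum_univ_add (b := l) (fun i => ‖b i‖), mul_add,
        ← add_assoc, Finset.mul_sum, Finset.mul_sum]
      refine le_add_of_le_of_nonneg (add_le_add ?_ ?_)
        (mul_nonneg (hN0 n).le (Finset.sum_nonneg fun i _ => norm_nonneg _))
      · refine Finset.sum_le_sum fun i _ => ?_
        simp only [f, Sum.elim_inl]
        rw [norm_smul, Real.norm_of_nonneg (inv_nonneg.2 (hd0 n i).le)]
        exact mul_le_mul_of_nonneg_right ((inv_le_one_of_one_le₀ (hd1 n i)).trans (hN n))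
          (norm_nonneg _)
      · refine Finset.sum_le_sum fun i _ => ?_
        simp only [f, Sum.elim_inr]
        rw [norm_smul, Real.norm_of_nonneg (hd0 n _).le]
        exact mul_le_mul_of_nonneg_right (blockScale_castAdd_le (hN n) i) (norm_nonneg _)
    · have : Tendsto (fun n => (∑ i, ‖a i‖ + ∑ i, ‖b i‖) / N n) atTop (𝓝 0) :=
        tendsto_const_nhds.div_atTop hNlim
      refine this.congr fun n => ?_
      rw [sq, mul_div_mul_left _ _ (hN0 n).ne']

end PPAV

theorem theorem2p2 (g c : ℕ) (hc : c < g) (p : SiegelUpperHalfSpace c) :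
    (∀ A : ℕ → PPAV g, PPAV.ConvergesTo A (SatakeBB.mk c hc.le p) →
      ∃ φ : ℕ → ℕ, StrictMono φ ∧ ∃ r : ℕ, c ≤ r ∧ r < g ∧
        ∃ (Λ : Submodule ℤ (EuclideanSpace ℝ (Fin (g - r)))) (_ : DiscreteTopology Λ)
          (_ : IsZLattice ℝ Λ),
          Metric.diam (Set.univ : Set (FlatTorus Λ)) = 1 ∧
          PPAV.GHTendsto (fun n => A (φ n)) (FlatTorus Λ)) ∧
    (∀ r : ℕ, c ≤ r → r < g →
      ∀ (Λ : Submodule ℤ (EuclideanSpace ℝ (Fin (g - r)))) [DiscreteTopology Λ] [IsZLattice ℝ Λ],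
        Metric.diam (Set.univ : Set (FlatTorus Λ)) = 1 →
        ∃ A : ℕ → PPAV g, PPAV.ConvergesTo A (SatakeBB.mk c hc.le p) ∧
          PPAV.GHTendsto A (FlatTorus Λ)) := by
  refine ⟨fun A hA => hA.exists_gHTendsto hc, fun r hcr hrg Λ _ _ hdiam => ?_⟩
  -- The block sizes are `c`, `k = r - c` and `l = g - r`, the last being the dimension of the
  -- torus.
  obtain ⟨k, rfl⟩ := Nat.exists_eq_add_of_le hcr
  obtain ⟨l, rfl⟩ := Nat.exists_eq_add_of_le hrg.le
  have hfree : Module.Free ℤ Λ := ZLattice.module_free ℝ Λ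
  have hfin : Module.Finite ℤ Λ := ZLattice.module_finite ℝ Λ
  let e : Module.Basis (Fin l) ℤ Λ := Module.finBasisOfFinrankEq ℤ Λ (by
    rw [ZLattice.rank ℝ Λ, finrank_euclideanSpace_fin, Nat.add_sub_cancel_left])
  exact PPAV.exists_convergesTo_gHTendsto k p (e.ofZLatticeBasis ℝ Λ) (e.ofZLatticeBasis_span ℝ Λ)
    hdiam
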